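/- Let $\mathcal H$ be a separable real or complex Hilbert space and let $A$ be a bounded positive (self-adjoint, positive semidefinite) operator on $\mathcal H$ with spectral measure $E$, i.e. the projection-valued Borel measure on $\mathbb R$ with $A=\int t\,dE(t)$. Suppose that every nonzero spectral projection $E(S)$ of $A$, $S\subseteq\mathbb R$ Borel, has infinite rank. If $\|A\|>1$, then $A$ is the sum of a finite or infinite sequence of (not necessarily mutually orthogonal) self-adjoint projections, each of infinite rank, with convergence in the strong operator topology. -/

import Mathlib

open MeasureTheory Filter Topology

section SpectralProjections

variable {𝕜 H : Type*} [RCLike 𝕜] [NormedAddCommGroup H] [InnerProductSpace 𝕜 H] [CompleteSpace H]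

variable (𝕜 H) in
/-- A projection-valued measure on the Borel sets of `ℝ` with values in the orthogonal projections
of the Hilbert space `H`, countably additive in the strong operator topology.
Only the values at Borel sets are meaningful. -/
structure ProjValuedMeasure where
  /-- the projection attached to a set -/
  proj : Set ℝ → (H →L[𝕜] H)
  isStarProjection : ∀ S, MeasurableSet S → IsStarProjection (proj S)
  empty : proj ∅ = 0
  univ : proj Set.univ = 1
  inter : ∀ S T, MeasurableSet S → MeasurableSet T → proj (S ∩ T) = proj S * proj T
  hasSum_iUnion : ∀ S : ℕ → Set ℝ, (∀ n, MeasurableSet (S n)) →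
    Pairwise (Function.onFun Disjoint S) →
    ∀ x : H, HasSum (fun n => proj (S n) x) (proj (⋃ n, S n) x)

namespace ProjValuedMeasure

theorem norm_sq_proj (E : ProjValuedMeasure 𝕜 H) {S : Set ℝ} (hS : MeasurableSet S) (x : H) :
    ‖E.proj S x‖ ^ 2 = RCLike.re (inner 𝕜 x (E.proj S x)) := by
  have h := E.isStarProjection S hS
  have h1 : E.proj S (E.proj S x) = E.proj S x := by
    have := congrArg (fun T : H →L[𝕜] H => T x) h.isIdempotentElem.eq
    simpa using this
  have h2 := h.isSelfAdjoint
  rw [ContinuousLinearMap.isSelfAdjoint_iff_isSymmetric] at h2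
  have h3 : inner 𝕜 (E.proj S x) (E.proj S x) = inner 𝕜 x (E.proj S (E.proj S x)) :=
    h2 x (E.proj S x)
  rw [h1] at h3
  rw [← h3, inner_self_eq_norm_sq]

/-- The scalar measure `S ↦ ⟨E(S)x, x⟩ = ‖E(S)x‖²` on the Borel sets of `ℝ`. -/
noncomputable def scalarMeasure (E : ProjValuedMeasure 𝕜 H) (x : H) : Measure ℝ :=
  Measure.ofMeasurable (fun S _ => ENNReal.ofReal (‖E.proj S x‖ ^ 2))
    (by simp [E.empty])
    (by
      intro S hS hd
      have h1 : HasSum (fun n => ‖E.proj (S n) x‖ ^ 2) (‖E.proj (⋃ n, S n) x‖ ^ 2) := by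
        rw [norm_sq_proj E (MeasurableSet.iUnion hS)]
        simp_rw [fun n => norm_sq_proj E (hS n) x]
        exact ((E.hasSum_iUnion S hS hd x).mapL (innerSL 𝕜 x)).mapL RCLike.reCLM
      show ENNReal.ofReal _ = _
      rw [← h1.tsum_eq, ENNReal.ofReal_tsum_of_nonneg (fun n => sq_nonneg _) h1.summable])

theorem scalarMeasure_apply (E : ProjValuedMeasure 𝕜 H) (x : H) {S : Set ℝ}
    (hS : MeasurableSet S) : E.scalarMeasure x S = ENNReal.ofReal (‖E.proj S x‖ ^ 2) :=
  Measure.ofMeasurable_apply S hS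

end ProjValuedMeasure

/-- `E` is the spectral measure of the bounded self-adjoint operator `A`: `A = ∫ t dE(t)`, that is,
`⟨A x, x⟩ = ∫ t d⟨E(t)x, x⟩` for every `x`. -/
structure IsSpectralMeasure (A : H →L[𝕜] H) (E : ProjValuedMeasure 𝕜 H) : Prop where
  isSelfAdjoint : IsSelfAdjoint A
  integrable : ∀ x : H, Integrable (fun t : ℝ => t) (E.scalarMeasure x)
  inner_eq : ∀ x : H, inner 𝕜 x (A x) = ((∫ t, t ∂(E.scalarMeasure x) : ℝ) : 𝕜)

/-- `P` is a spectral projection of `A`: the value of the spectral measure of `A` at some Borel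
subset of `ℝ`. -/
def IsSpectralProjection (A P : H →L[𝕜] H) : Prop :=
  ∃ E : ProjValuedMeasure 𝕜 H, IsSpectralMeasure A E ∧ ∃ S, MeasurableSet S ∧ P = E.proj S

/-- The operator `T` has infinite rank. -/
def HasInfiniteRank (T : H →L[𝕜] H) : Prop :=
  ¬ FiniteDimensional 𝕜 (LinearMap.range (T : H →ₗ[𝕜] H))

/-- `A` is the sum of a finite or infinite sequence of (not necessarily mutually orthogonal)
self-adjoint projections, each of infinite rank, with convergence in the strong operator
topology. -/
def HasInfiniteRankProjectionDecomposition (A : H →L[𝕜] H) : Prop :=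
  (∃ (n : ℕ) (P : Fin n → (H →L[𝕜] H)),
    (∀ i, IsStarProjection (P i) ∧ HasInfiniteRank (P i)) ∧ A = ∑ i, P i) ∨
  (∃ P : ℕ → (H →L[𝕜] H),
    (∀ i, IsStarProjection (P i) ∧ HasInfiniteRank (P i)) ∧
    ∀ x : H, Tendsto (fun n => ∑ i ∈ Finset.range n, P i x) atTop (𝓝 (A x)))

end SpectralProjections

/-! ### Real polynomials in a self-adjoint operator, and measures with prescribed moments. -/

section PolynomialCalculus

open Polynomial

variable {𝕜 H : Type*} [RCLike 𝕜] [NormedAddCommGroup H] [InnerProductSpace 𝕜 H]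

/-! Choose `1 < c < ‖A‖`. The spectral projection of `A` on `(c, ∞)` is nonzero, since otherwise
`‖A‖ ≤ c`; by hypothesis its range `M` is infinite-dimensional, and there `A ≥ c = 1 + ε`. This is
the only use of the spectral hypothesis. It requires an actual projection-valued measure for `A`, so
the spectral theorem is proved along the way: compressions to Krylov subspaces and weak compactness
give each vector `x` a measure with moments `⟨x, A ^ k x⟩`, and the spectral subspace of `S`
consists of the vectors whose measure lives on `S`.

Next write `A = T T†` with `T (x, y) = √A x` on `K = H ⊕ H`. If `K` is an orthogonal sum of
subspaces `G j` with projections `E j`, and `T` is isometric on each `G j`, then `T (E j) T†` is the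
projection onto `T (G j)`, and these projections sum strongly to `T T† = A`. Isometry on `G j` means
that the compression of `S = T† T - 1` to `G j` vanishes. So `K` needs an orthonormal basis, split
into infinitely many infinite classes, with `S` vanishing between members of one class.

Such a basis exists because `S = (A - 1) ⊕ (-1)` is at least `ε` on `M ⊕ 0` and equals `-1` on `0 ⊕
M`, both infinite-dimensional. Hence every small value of its quadratic form is attained at unit
vectors orthogonal to any given finite-dimensional space (`exists_unit_inner_eq`). Rotating a vector
against such auxiliary vectors reduces its value to zero in finitely many steps
(`IsIsotropicFamily.exists_mem_span_of_unit`); doing this along a dense sequence gives a total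
family (`exists_isIsotropicFamily`). -/

/-- Evaluation of real polynomials at a bounded operator. -/
noncomputable def polyOp (A : H →L[𝕜] H) : ℝ[X] →+* (H →L[𝕜] H) :=
  (aeval (R := 𝕜) A).toRingHom.comp (mapRingHom (algebraMap ℝ 𝕜))

theorem polyOp_X (A : H →L[𝕜] H) : polyOp A X = A := by simp [polyOp]

theorem polyOp_C (A : H →L[𝕜] H) (a : ℝ) : polyOp A (C a) = (a : 𝕜) • 1 := by
  simp [polyOp, Algebra.algebraMap_eq_smul_one]

theorem polyOp_C_apply (A : H →L[𝕜] H) (a : ℝ) (x : H) : polyOp A (C a) x = (a : 𝕜) • x := by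
  simp [polyOp_C]

theorem polyOp_mul_apply (A : H →L[𝕜] H) (p q : ℝ[X]) (x : H) :
    polyOp A (p * q) x = polyOp A p (polyOp A q x) := by
  rw [map_mul]; rfl

theorem polyOp_eq_sum (A : H →L[𝕜] H) (p : ℝ[X]) (x : H) :
    polyOp A p x = p.sum fun k a => (a : 𝕜) • (A ^ k) x := by
  conv_lhs => rw [p.as_sum_support_C_mul_X_pow]
  rw [map_sum, Polynomial.sum_def, _root_.sum_apply]
  refine Finset.sum_congr rfl fun k _ => ?_
  rw [polyOp_mul_apply, polyOp_C_apply, map_pow, polyOp_X]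

variable [CompleteSpace H]

theorem inner_pow_left {A : H →L[𝕜] H} (hA : IsSelfAdjoint A) (k : ℕ) (x y : H) :
    inner 𝕜 ((A ^ k) x) y = inner 𝕜 x ((A ^ k) y) :=
  (ContinuousLinearMap.isSelfAdjoint_iff_isSymmetric.1 (hA.pow k)) x y

theorem polyOp_inner_left {A : H →L[𝕜] H} (hA : IsSelfAdjoint A) (p : ℝ[X]) (x y : H) :
    inner 𝕜 (polyOp A p x) y = inner 𝕜 x (polyOp A p y) := by
  simp only [polyOp_eq_sum, Polynomial.sum_def, sum_inner, inner_sum, inner_smul_left,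
    inner_smul_right, inner_pow_left hA, RCLike.conj_ofReal]

theorem polyOp_isSelfAdjoint {A : H →L[𝕜] H} (hA : IsSelfAdjoint A) (p : ℝ[X]) :
    IsSelfAdjoint (polyOp A p) :=
  ContinuousLinearMap.isSelfAdjoint_iff_isSymmetric.2 (polyOp_inner_left hA p)

theorem norm_sq_polyOp {A : H →L[𝕜] H} (hA : IsSelfAdjoint A) (p : ℝ[X]) (x : H) :
    ‖polyOp A p x‖ ^ 2 = RCLike.re (inner 𝕜 x (polyOp A (p ^ 2) x)) := by
  rw [sq p, polyOp_mul_apply, ← polyOp_inner_left hA, inner_self_eq_norm_sq]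

/-- A quadrature formula for the moments of a self-adjoint operator, from the diagonalization of its
compression to a Krylov subspace. -/
theorem exists_quadrature {A : H →L[𝕜] H} (hA : IsSelfAdjoint A) (x : H) (N : ℕ) :
    ∃ (n : ℕ) (l w : Fin n → ℝ), (∀ i, |l i| ≤ ‖A‖) ∧ (∀ i, 0 ≤ w i) ∧
      ∀ k ≤ N, RCLike.re (inner 𝕜 x ((A ^ k) x)) = ∑ i, w i * l i ^ k := by
  let V : Submodule 𝕜 H := Submodule.span 𝕜 ((fun k => (A ^ k) x) '' Set.Iic N)
  have hVmem : ∀ k ≤ N, (A ^ k) x ∈ V := fun k hk => Submodule.subset_span ⟨k, hk, rfl⟩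
  have : FiniteDimensional 𝕜 V :=
    FiniteDimensional.span_of_finite 𝕜 ((Set.finite_Iic N).image _)
  let T : V →ₗ[𝕜] V := (V.orthogonalProjectionOnto.comp (A.comp V.subtypeL) : V →L[𝕜] V)
  have hTapp : ∀ v : V, T v = V.orthogonalProjectionOnto (A v) := fun v => rfl
  have hT : T.IsSymmetric := by
    intro u v
    rw [hTapp, hTapp, Submodule.inner_orthogonalProjectionOnto_eq_of_mem_right,
      Submodule.inner_orthogonalProjectionOnto_eq_of_mem_left]
    simpa using inner_pow_left hA 1 (u : H) v
  let x' : V := ⟨x, by simpa using hVmem 0 (Nat.zero_le _)⟩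
  -- Up to exponent `N` the orbit of `x` stays in `V`, so the projection in `T` does not alter it.
  have hpow : ∀ k ≤ N, (((T ^ k) x' : V) : H) = (A ^ k) x := by
    intro k
    induction k with
    | zero => intro _; simp [x']
    | succ k ih =>
      intro hk
      rw [pow_succ', Module.End.mul_apply, hTapp, ih (by omega)]
      have : A ((A ^ k) x) = (A ^ (k + 1)) x := by rw [pow_succ']; rfl
      rw [this]
      exact V.starProjection_eq_self_iff.2 (hVmem _ hk)
  let b := hT.eigenvectorBasis rfl
  let l := hT.eigenvalues rfl
  have hTb : ∀ i, T (b i) = (l i : 𝕜) • b i := fun i => hT.apply_eigenvectorBasis rfl i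
  have hTk : ∀ k i, (T ^ k) (b i) = ((l i : 𝕜) ^ k) • b i := by
    intro k i
    induction k with
    | zero => simp
    | succ k ih =>
      rw [pow_succ', Module.End.mul_apply, ih, map_smul, hTb, smul_smul, pow_succ]
  -- Nodes and weights are the eigenvalues of `T` and the squared coordinates of `x'` in an
  -- eigenbasis.
  refine ⟨_, l, fun i => ‖inner 𝕜 (b i) x'‖ ^ 2, fun i => ?_, fun i => sq_nonneg _, ?_⟩
  · have h1 : ‖T (b i)‖ ≤ ‖A‖ := by
      rw [hTapp]
      refine (V.norm_orthogonalProjectionOnto_apply_le _).trans ((A.le_opNorm _).trans ?_)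
      have : ‖((b i : V) : H)‖ = 1 := b.orthonormal.1 i
      rw [this, mul_one]
    rw [hTb, norm_smul, b.orthonormal.1 i, mul_one, RCLike.norm_ofReal] at h1
    exact h1
  · intro k hk
    have hs : (T ^ k).IsSymmetric := hT.pow k
    have h1 : inner 𝕜 x ((A ^ k) x) = inner 𝕜 x' ((T ^ k) x') := by
      rw [← hpow k hk]; rfl
    rw [h1, ← b.sum_inner_mul_inner x' ((T ^ k) x'), map_sum]
    refine Finset.sum_congr rfl fun i _ => ?_
    rw [← hs, hTk, inner_smul_left, map_pow, RCLike.conj_ofReal, mul_left_comm,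
      ← inner_conj_symm x' (b i), RCLike.conj_mul]
    norm_cast
    exact mul_comm _ _

/-- The finite measure `μ` is supported on `[-‖A‖, ‖A‖]` and has the moments `⟨x, A ^ k x⟩`. -/
structure IsMomentMeasure (A : H →L[𝕜] H) (x : H) (μ : Measure ℝ) : Prop where
  isFiniteMeasure : IsFiniteMeasure μ
  compl_Icc : μ (Set.Icc (-‖A‖) ‖A‖)ᶜ = 0
  integral_eval : ∀ p : ℝ[X], ∫ t, p.eval t ∂μ = RCLike.re (inner 𝕜 x (polyOp A p x))

/-- The clamping of a polynomial to the interval `[-r, r]`. -/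
noncomputable def clampEval (r : ℝ) (hr : 0 ≤ r) (p : ℝ[X]) : BoundedContinuousFunction ℝ ℝ :=
  (BoundedContinuousFunction.mkOfCompact (p.toContinuousMapOn (Set.Icc (-r) r))).compContinuous
    ⟨Set.projIcc (-r) r (by linarith), continuous_projIcc⟩

theorem clampEval_apply {r : ℝ} (hr : 0 ≤ r) (p : ℝ[X]) {t : ℝ} (ht : t ∈ Set.Icc (-r) r) :
    clampEval r hr p t = p.eval t := by
  simp [clampEval, Set.projIcc_of_mem _ ht]

/-- Weak convergence is tested on bounded continuous functions only; clamping makes polynomials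
admissible without changing their integrals. -/
theorem integral_clampEval {r : ℝ} (hr : 0 ≤ r) (p : ℝ[X]) {μ : Measure ℝ}
    (hμ : μ (Set.Icc (-r) r)ᶜ = 0) : ∫ t, clampEval r hr p t ∂μ = ∫ t, p.eval t ∂μ := by
  refine integral_congr_ae ?_
  filter_upwards [measure_eq_zero_iff_ae_notMem.1 hμ] with t ht
  exact clampEval_apply hr p (by simpa using ht)

/-- Approximate moment measures: correct for polynomials of degree at most `N`. -/
theorem exists_measure_degree_le {A : H →L[𝕜] H} (hA : IsSelfAdjoint A) (x : H) (N : ℕ) :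
    ∃ μ : FiniteMeasure ℝ, μ.mass ≤ ‖x‖₊ ^ 2 ∧ μ (Set.Icc (-‖A‖) ‖A‖)ᶜ = 0 ∧
      ∀ p : ℝ[X], p.natDegree ≤ N →
        ∫ t, p.eval t ∂(μ : Measure ℝ) = RCLike.re (inner 𝕜 x (polyOp A p x)) := by
  obtain ⟨n, l, w, hl, hw, h⟩ := exists_quadrature hA x N
  let ν : Measure ℝ := ∑ i, ENNReal.ofReal (w i) • Measure.dirac (l i)
  have hmass : ν Set.univ = ENNReal.ofReal (‖x‖ ^ 2) := by
    have h0 := h 0 (Nat.zero_le _)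
    simp only [pow_zero, one_apply_eq_self, inner_self_eq_norm_sq, mul_one] at h0
    simp [ν, h0, ENNReal.ofReal_sum_of_nonneg fun i _ => hw i]
  have hfin : IsFiniteMeasure ν := ⟨by rw [hmass]; exact ENNReal.ofReal_lt_top⟩
  let M : FiniteMeasure ℝ := ⟨ν, hfin⟩
  have hM : (M : Measure ℝ) = ν := rfl
  refine ⟨M, ?_, ?_, ?_⟩
  · rw [← ENNReal.coe_le_coe, FiniteMeasure.ennreal_mass, hM, hmass, ENNReal.ofReal_le_iff_le_toReal (by simp)]
    simp
  · rw [FiniteMeasure.null_iff_toMeasure_null, hM]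
    simp only [ν, Measure.finsetSum_apply, Measure.smul_apply, smul_eq_mul]
    refine Finset.sum_eq_zero fun i _ => ?_
    rw [Measure.dirac_apply' _ measurableSet_Icc.compl, Set.indicator_of_notMem, mul_zero]
    simpa using abs_le.1 (hl i)
  · intro p hp
    rw [hM]
    have h1 : ∫ t, p.eval t ∂ν = ∑ i, w i * p.eval (l i) := by
      rw [integral_finsetSum_measure]
      · simp [integral_smul_measure, ENNReal.toReal_ofReal, hw]
      · intro i _
        exact (integrable_dirac (by simp)).smul_measure ENNReal.ofReal_ne_top
    rw [h1, polyOp_eq_sum, Polynomial.sum_over_range' p (by simp) (N + 1) (by omega), inner_sum,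
      map_sum]
    simp_rw [Polynomial.eval_eq_sum_range' (show p.natDegree < N + 1 by omega), Finset.mul_sum]
    rw [Finset.sum_comm]
    refine Finset.sum_congr rfl fun k hk => ?_
    rw [inner_smul_right, RCLike.re_ofReal_mul, h k (by simpa [Nat.lt_succ_iff] using hk),
      Finset.mul_sum]
    exact Finset.sum_congr rfl fun i _ => by ring

/-- Measures on a fixed compact interval with bounded mass form a weakly compact set, so the
quadrature measures converge along a nonprincipal ultrafilter. Each moment is exact from some index
on, hence exact in the limit. -/
theorem exists_isMomentMeasure {A : H →L[𝕜] H} (hA : IsSelfAdjoint A) (x : H) :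
    ∃ μ : Measure ℝ, IsMomentMeasure A x μ := by
  choose ν hmass hsupp hint using exists_measure_degree_le hA x
  have hc := isCompact_setOfPred_finiteMeasure_le_of_isCompact (‖x‖₊ ^ 2)
    (isCompact_Icc (a := -‖A‖) (b := ‖A‖))
  obtain ⟨μ, hμ, hlim⟩ := hc.ultrafilter_le_nhds ((hyperfilter ℕ : Ultrafilter ℕ).map ν) (by
    rw [Ultrafilter.coe_map, le_principal_iff]
    exact Filter.mem_map.2 (univ_mem' fun N => ⟨hmass N, hsupp N⟩))
  have hμ' : (μ : Measure ℝ) (Set.Icc (-‖A‖) ‖A‖)ᶜ = 0 :=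
    (FiniteMeasure.null_iff_toMeasure_null _ _).1 hμ.2
  refine ⟨μ, inferInstance, hμ', fun p => ?_⟩
  have ht : Tendsto ν (hyperfilter ℕ : Filter ℕ) (𝓝 μ) := hlim
  rw [FiniteMeasure.tendsto_iff_forall_integral_tendsto] at ht
  have ht := ht (clampEval ‖A‖ (norm_nonneg A) p)
  rw [integral_clampEval _ _ hμ'] at ht
  refine tendsto_nhds_unique ht (tendsto_const_nhds.congr' ?_)
  refine Nat.hyperfilter_le_atTop ?_
  filter_upwards [eventually_ge_atTop p.natDegree] with N hN
  rw [integral_clampEval _ _ ((FiniteMeasure.null_iff_toMeasure_null _ _).1 (hsupp N)), hint N p hN]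

end PolynomialCalculus

/-! ### The spectral measure of a vector, and spectral subspaces. -/

section MomentMeasure

open Polynomial

theorem integrable_of_continuous_of_compl_Icc {r : ℝ} {μ : Measure ℝ} [IsFiniteMeasure μ]
    (hμ : μ (Set.Icc (-r) r)ᶜ = 0) {f : ℝ → ℝ} (hf : Continuous f) : Integrable f μ := by
  have h : IntegrableOn f (Set.Icc (-r) r) μ :=
    hf.continuousOn.integrableOn_compact isCompact_Icc
  have hae : ∀ᵐ t ∂μ, t ∈ Set.Icc (-r) r := mem_ae_iff.2 hμ
  rwa [IntegrableOn, Measure.restrict_eq_self_of_ae_mem hae] at h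

theorem integrable_eval {r : ℝ} {μ : Measure ℝ} [IsFiniteMeasure μ]
    (hμ : μ (Set.Icc (-r) r)ᶜ = 0) (p : ℝ[X]) : Integrable (fun t => p.eval t) μ :=
  integrable_of_continuous_of_compl_Icc hμ p.continuous

/-- Compactly supported finite measures on `ℝ` are determined by their moments. -/
theorem measure_eq_of_integral_eval_eq {r : ℝ} {μ ν : Measure ℝ} [IsFiniteMeasure μ]
    [IsFiniteMeasure ν] (hμ : μ (Set.Icc (-r) r)ᶜ = 0) (hν : ν (Set.Icc (-r) r)ᶜ = 0)
    (h : ∀ p : ℝ[X], ∫ t, p.eval t ∂μ = ∫ t, p.eval t ∂ν) : μ = ν := by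
  refine ext_of_forall_integral_eq_of_IsFiniteMeasure fun f => ?_
  have key : ∀ (κ : Measure ℝ) [IsFiniteMeasure κ], κ (Set.Icc (-r) r)ᶜ = 0 →
      ∀ (p : ℝ[X]) (ε : ℝ), (∀ t ∈ Set.Icc (-r) r, |p.eval t - f t| < ε) →
        |∫ t, p.eval t ∂κ - ∫ t, f t ∂κ| ≤ ε * κ.real Set.univ := by
    intro κ _ hκ p ε hp
    rw [← integral_sub (integrable_eval hκ p) (integrable_of_continuous_of_compl_Icc hκ f.continuous)]
    rw [← Real.norm_eq_abs]
    refine norm_integral_le_of_norm_le_const ?_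
    filter_upwards [measure_eq_zero_iff_ae_notMem.1 hκ] with t ht
    exact (hp t (by simpa using ht)).le
  refine eq_of_abs_sub_le_all fun ε hε => ?_
  have hM : 0 < μ.real Set.univ + ν.real Set.univ + 1 := by positivity
  obtain ⟨p, hp⟩ := exists_polynomial_near_of_continuousOn (-r) r f f.continuous.continuousOn
    (ε / (μ.real Set.univ + ν.real Set.univ + 1)) (by positivity)
  have h1 := key μ hμ p _ hp
  have h2 := key ν hν p _ hp
  rw [h p] at h1
  have h3 : ε / (μ.real Set.univ + ν.real Set.univ + 1) * μ.real Set.univ +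
      ε / (μ.real Set.univ + ν.real Set.univ + 1) * ν.real Set.univ ≤ ε := by
    rw [← mul_add, div_mul_eq_mul_div, div_le_iff₀ hM]
    nlinarith
  calc |∫ t, f t ∂μ - ∫ t, f t ∂ν|
      = |(∫ t, p.eval t ∂ν - ∫ t, f t ∂ν) - (∫ t, p.eval t ∂ν - ∫ t, f t ∂μ)| := by
        congr 1; ring
    _ ≤ _ := abs_sub _ _
    _ ≤ ε := by linarith

/-- Polynomials approximate indicator functions in the mean square. -/
theorem exists_polynomial_integral_sq_le {r : ℝ} {μ : Measure ℝ} [IsFiniteMeasure μ]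
    (hμ : μ (Set.Icc (-r) r)ᶜ = 0) {S : Set ℝ} (hS : MeasurableSet S) {ε : ℝ} (hε : 0 < ε) :
    ∃ p : ℝ[X], Integrable (fun t => (p.eval t - S.indicator 1 t) ^ 2) μ ∧
      ∫ t, (p.eval t - S.indicator 1 t) ^ 2 ∂μ ≤ ε := by
  have hmem : MemLp (S.indicator (1 : ℝ → ℝ)) (ENNReal.ofReal 2) μ :=
    (memLp_const (1 : ℝ)).indicator hS
  -- Since `(a - b)² ≤ 2a² + 2b²`, an error of `ε / 4` in each of the two approximations suffices.
  obtain ⟨g, hg, hgm⟩ := hmem.exists_boundedContinuous_integral_rpow_sub_le two_pos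
    (show 0 < ε / 4 by positivity)
  have hM : 0 < μ.real Set.univ + 1 := by positivity
  obtain ⟨p, hp⟩ := exists_polynomial_near_of_continuousOn (-r) r g g.continuous.continuousOn
    (√(ε / (4 * (μ.real Set.univ + 1)))) (by positivity)
  have i1 : Integrable (fun t => (S.indicator 1 t - g t) ^ 2) μ := by
    have := (hmem.sub hgm).integrable_norm_rpow (by simp) (by simp)
    simpa using this
  have i2 : Integrable (fun t => (p.eval t - g t) ^ 2) μ :=
    integrable_of_continuous_of_compl_Icc hμ (by fun_prop)
  have hle : ∀ t, (p.eval t - S.indicator 1 t) ^ 2 ≤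
      2 * (p.eval t - g t) ^ 2 + 2 * (S.indicator 1 t - g t) ^ 2 := fun t => by
    nlinarith [sq_nonneg (p.eval t - g t + (S.indicator 1 t - g t))]
  have i3 : Integrable (fun t => (p.eval t - S.indicator 1 t) ^ 2) μ := by
    refine ((i2.const_mul 2).add (i1.const_mul 2)).mono' ?_ (ae_of_all _ fun t => ?_)
    · exact ((p.continuous.measurable.sub (measurable_one.indicator hS)).pow_const
        2).aestronglyMeasurable
    · rw [Real.norm_of_nonneg (sq_nonneg _)]
      exact hle t
  refine ⟨p, i3, ?_⟩
  have h1 : ∫ t, (p.eval t - g t) ^ 2 ∂μ ≤ ε / 4 := by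
    have : ‖∫ t, (p.eval t - g t) ^ 2 ∂μ‖ ≤
        ε / (4 * (μ.real Set.univ + 1)) * μ.real Set.univ := by
      refine norm_integral_le_of_norm_le_const ?_
      filter_upwards [measure_eq_zero_iff_ae_notMem.1 hμ] with t ht
      have := hp t (by simpa using ht)
      rw [Real.norm_of_nonneg (sq_nonneg _), ← sq_abs]
      calc |p.eval t - g t| ^ 2 ≤ √(ε / (4 * (μ.real Set.univ + 1))) ^ 2 := by gcongr
        _ = _ := Real.sq_sqrt (by positivity)
    refine (le_abs_self _).trans (this.trans ?_)
    rw [div_mul_eq_mul_div, div_le_div_iff₀ (by positivity) (by positivity)]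
    nlinarith
  have h2 : ∫ t, (S.indicator 1 t - g t) ^ 2 ∂μ ≤ ε / 4 := by simpa using hg
  calc ∫ t, (p.eval t - S.indicator 1 t) ^ 2 ∂μ
      ≤ ∫ t, (2 * (p.eval t - g t) ^ 2 + 2 * (S.indicator 1 t - g t) ^ 2) ∂μ :=
        integral_mono i3 ((i2.const_mul 2).add (i1.const_mul 2)) hle
    _ = 2 * ∫ t, (p.eval t - g t) ^ 2 ∂μ + 2 * ∫ t, (S.indicator 1 t - g t) ^ 2 ∂μ := by
        rw [integral_add (i2.const_mul 2) (i1.const_mul 2), integral_const_mul, integral_const_mul]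
    _ ≤ ε := by linarith

variable {𝕜 H : Type*} [RCLike 𝕜] [NormedAddCommGroup H] [InnerProductSpace 𝕜 H]
  {A : H →L[𝕜] H}

theorem IsMomentMeasure.unique {x : H} {μ ν : Measure ℝ} (hμ : IsMomentMeasure A x μ)
    (hν : IsMomentMeasure A x ν) : μ = ν := by
  have := hμ.isFiniteMeasure
  have := hν.isFiniteMeasure
  exact measure_eq_of_integral_eval_eq hμ.compl_Icc hν.compl_Icc fun p => by
    rw [hμ.integral_eval, hν.integral_eval]

variable [CompleteSpace H]

/-- The spectral measure of the self-adjoint operator `A` at the vector `x`. -/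
noncomputable def momentMeasure (hA : IsSelfAdjoint A) (x : H) : Measure ℝ :=
  (exists_isMomentMeasure hA x).choose

variable (hA : IsSelfAdjoint A)

theorem isMomentMeasure_momentMeasure (x : H) : IsMomentMeasure A x (momentMeasure hA x) :=
  (exists_isMomentMeasure hA x).choose_spec

instance (x : H) : IsFiniteMeasure (momentMeasure hA x) :=
  (isMomentMeasure_momentMeasure hA x).isFiniteMeasure

theorem momentMeasure_compl_Icc (x : H) : momentMeasure hA x (Set.Icc (-‖A‖) ‖A‖)ᶜ = 0 :=
  (isMomentMeasure_momentMeasure hA x).compl_Icc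

theorem integral_eval_momentMeasure (x : H) (p : ℝ[X]) :
    ∫ t, p.eval t ∂(momentMeasure hA x) = RCLike.re (inner 𝕜 x (polyOp A p x)) :=
  (isMomentMeasure_momentMeasure hA x).integral_eval p

theorem norm_sq_polyOp_eq_integral (x : H) (p : ℝ[X]) :
    ‖polyOp A p x‖ ^ 2 = ∫ t, p.eval t ^ 2 ∂(momentMeasure hA x) := by
  rw [norm_sq_polyOp hA, ← integral_eval_momentMeasure hA]
  simp

theorem momentMeasure_univ (x : H) : momentMeasure hA x Set.univ = ENNReal.ofReal (‖x‖ ^ 2) := by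
  have h := norm_sq_polyOp_eq_integral hA x 1
  rw [map_one, one_apply_eq_self] at h
  rw [h]
  simp [Measure.real]

/-- The hypothesis removes the cross terms from every moment. -/
theorem momentMeasure_add_of_inner_eq_zero {x y : H}
    (h : ∀ p : ℝ[X], inner 𝕜 x (polyOp A p y) = 0) :
    momentMeasure hA (x + y) = momentMeasure hA x + momentMeasure hA y := by
  refine (isMomentMeasure_momentMeasure hA (x + y)).unique ⟨inferInstance, ?_, fun p => ?_⟩
  · simp [momentMeasure_compl_Icc]
  · rw [integral_add_measure (integrable_eval (momentMeasure_compl_Icc hA x) p)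
      (integrable_eval (momentMeasure_compl_Icc hA y) p), integral_eval_momentMeasure,
      integral_eval_momentMeasure]
    have h2 : inner 𝕜 y (polyOp A p x) = 0 := by
      rw [← inner_conj_symm, polyOp_inner_left hA, h, map_zero]
    simp [inner_add_left, inner_add_right, h, h2]

/-- Every moment is a quadratic form in the vector, so the parallelogram law passes to the measures.
Dropping one term on the left gives `momentMeasure_add_le`, which makes spectral subspaces linear.
-/
theorem momentMeasure_parallelogram (x y : H) :
    momentMeasure hA (x + y) + momentMeasure hA (x - y) =
      momentMeasure hA x + momentMeasure hA y + (momentMeasure hA x + momentMeasure hA y) := by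
  have hs := momentMeasure_compl_Icc hA
  refine measure_eq_of_integral_eval_eq (r := ‖A‖) (by simp [hs]) (by simp [hs]) fun p => ?_
  have hi := fun z => integrable_eval (hs z) p
  rw [integral_add_measure (hi _) (hi _),
    integral_add_measure ((hi _).add_measure (hi _)) ((hi _).add_measure (hi _)),
    integral_add_measure (hi _) (hi _)]
  simp only [integral_eval_momentMeasure, inner_add_left, inner_add_right, inner_sub_left,
    inner_sub_right, map_add, map_sub]
  ring

theorem momentMeasure_add_le (x y : H) (S : Set ℝ) :
    momentMeasure hA (x + y) S ≤ 2 * (momentMeasure hA x S + momentMeasure hA y S) := by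
  have h := congrArg (fun μ : Measure ℝ => μ S) (momentMeasure_parallelogram hA x y)
  simp only [Measure.add_apply] at h
  rw [two_mul, ← h]
  exact le_self_add

theorem momentMeasure_smul (c : 𝕜) (x : H) :
    momentMeasure hA (c • x) = ENNReal.ofReal (‖c‖ ^ 2) • momentMeasure hA x := by
  refine (isMomentMeasure_momentMeasure hA (c • x)).unique
    ⟨Measure.smul_finite _ ENNReal.ofReal_ne_top, ?_, fun p => ?_⟩
  · simp [momentMeasure_compl_Icc]
  · rw [integral_smul_measure, integral_eval_momentMeasure, ENNReal.toReal_ofReal (sq_nonneg _),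
      map_smul, inner_smul_left, inner_smul_right, ← mul_assoc, RCLike.conj_mul]
    norm_cast
    rw [RCLike.re_ofReal_mul, smul_eq_mul]

/-- By self-adjointness `⟨p(A)x, q(A)p(A)x⟩ = ⟨x, (pqp)(A)x⟩`, and moments determine the measure. -/
theorem momentMeasure_polyOp (p : ℝ[X]) (x : H) :
    momentMeasure hA (polyOp A p x) =
      (momentMeasure hA x).withDensity fun t => ENNReal.ofReal (p.eval t ^ 2) := by
  have hs := momentMeasure_compl_Icc hA x
  have hc : Continuous fun t => p.eval t ^ 2 := by fun_prop
  have hi := integrable_of_continuous_of_compl_Icc hs hc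
  refine (isMomentMeasure_momentMeasure hA (polyOp A p x)).unique
    ⟨isFiniteMeasure_withDensity_ofReal hi.2, withDensity_absolutelyContinuous _ _ hs, fun q => ?_⟩
  rw [integral_withDensity_eq_integral_toReal_smul (by fun_prop) (by simp)]
  have h1 := integral_eval_momentMeasure hA x (p * (q * p))
  rw [polyOp_mul_apply, polyOp_mul_apply, ← polyOp_inner_left hA] at h1
  rw [← h1]
  refine integral_congr_ae (ae_of_all _ fun t => ?_)
  simp only [ENNReal.toReal_ofReal (sq_nonneg (p.eval t)), smul_eq_mul, eval_mul]
  ring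

/-- Quasi-subadditivity bounds the mass of `x` on `S` by twice `‖x - z n‖²` plus the mass of `z n`
on `S`. -/
theorem momentMeasure_eq_zero_of_tendsto {z : ℕ → H} {x : H} (hz : Tendsto z atTop (𝓝 x))
    {S : Set ℝ} (h : Tendsto (fun n => momentMeasure hA (z n) S) atTop (𝓝 0)) :
    momentMeasure hA x S = 0 := by
  have hle : ∀ n, momentMeasure hA x S ≤
      2 * (ENNReal.ofReal (‖x - z n‖ ^ 2) + momentMeasure hA (z n) S) := fun n => by
    have h1 := momentMeasure_add_le hA (x - z n) (z n) S
    rw [sub_add_cancel] at h1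
    refine h1.trans ?_
    gcongr
    rw [← momentMeasure_univ hA]
    exact measure_mono (Set.subset_univ _)
  have h2 : Tendsto (fun n => ENNReal.ofReal (‖x - z n‖ ^ 2)) atTop (𝓝 0) := by
    have : Tendsto (fun n => ‖x - z n‖ ^ 2) atTop (𝓝 0) := by
      simpa using ((tendsto_const_nhds (x := x)).sub hz).norm.pow 2
    simpa using ENNReal.tendsto_ofReal this
  have h3 := ENNReal.Tendsto.const_mul (a := 2) (h2.add h) (Or.inr (by simp))
  simp only [add_zero, mul_zero] at h3
  exact le_antisymm (ge_of_tendsto' h3 hle) zero_le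

/-- The vectors whose spectral measure is concentrated on `S`. -/
noncomputable def spectralSubspace (S : Set ℝ) : Submodule 𝕜 H where
  carrier := {x | momentMeasure hA x Sᶜ = 0}
  zero_mem' := by
    have h := momentMeasure_univ hA 0
    simp only [norm_zero, ne_eq, OfNat.ofNat_ne_zero, not_false_eq_true, zero_pow,
      ENNReal.ofReal_zero] at h
    exact measure_mono_null (Set.subset_univ _) h
  add_mem' {x y} hx hy := by
    have h := momentMeasure_add_le hA x y Sᶜ
    rw [Set.mem_ofPred_eq] at hx hy ⊢
    simpa [hx, hy] using h
  smul_mem' c x hx := by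
    rw [Set.mem_ofPred_eq] at hx ⊢
    simp [momentMeasure_smul, hx]

theorem mem_spectralSubspace {S : Set ℝ} {x : H} :
    x ∈ spectralSubspace hA S ↔ momentMeasure hA x Sᶜ = 0 := Iff.rfl

theorem isClosed_spectralSubspace (S : Set ℝ) : IsClosed (spectralSubspace hA S : Set H) := by
  refine IsSeqClosed.isClosed fun z x hz hx => ?_
  refine momentMeasure_eq_zero_of_tendsto hA hx ?_
  simp [fun n => (mem_spectralSubspace hA).1 (hz n)]

instance (S : Set ℝ) : CompleteSpace (spectralSubspace hA S) :=
  (isClosed_spectralSubspace hA S).completeSpace_coe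

theorem polyOp_mem_spectralSubspace (p : ℝ[X]) {S : Set ℝ} {x : H}
    (hx : x ∈ spectralSubspace hA S) : polyOp A p x ∈ spectralSubspace hA S := by
  rw [mem_spectralSubspace, momentMeasure_polyOp]
  exact withDensity_absolutelyContinuous _ _ hx

theorem spectralSubspace_inter (S T : Set ℝ) :
    spectralSubspace hA (S ∩ T) = spectralSubspace hA S ⊓ spectralSubspace hA T := by
  ext x
  simp [mem_spectralSubspace, Set.compl_inter, measure_union_null_iff]

end MomentMeasure

/-! ### Spectral projections and the projection-valued measure. -/

section SpectralTheorem

open Polynomial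

variable {𝕜 H : Type*} [RCLike 𝕜] [NormedAddCommGroup H] [InnerProductSpace 𝕜 H]
  [CompleteSpace H] {A : H →L[𝕜] H} (hA : IsSelfAdjoint A)

/-- When `p` is close to the indicator of `S`, `p(A)` nearly fixes the subspace of `S` and, by the
next lemma, nearly kills that of `Sᶜ`; both errors are the same integral. -/
theorem norm_sq_polyOp_sub_self {S : Set ℝ} {x : H} (hx : x ∈ spectralSubspace hA S) (p : ℝ[X]) :
    ‖polyOp A p x - x‖ ^ 2 = ∫ t, (p.eval t - S.indicator 1 t) ^ 2 ∂(momentMeasure hA x) := by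
  have h1 : polyOp A p x - x = polyOp A (p - 1) x := by simp
  rw [h1, norm_sq_polyOp_eq_integral hA]
  refine integral_congr_ae ?_
  filter_upwards [measure_eq_zero_iff_ae_notMem.1 ((mem_spectralSubspace hA).1 hx)] with t ht
  have ht' : t ∈ S := by simpa using ht
  simp [ht']

theorem norm_sq_polyOp_of_mem_compl {S : Set ℝ} {x : H} (hx : x ∈ spectralSubspace hA Sᶜ)
    (p : ℝ[X]) :
    ‖polyOp A p x‖ ^ 2 = ∫ t, (p.eval t - S.indicator 1 t) ^ 2 ∂(momentMeasure hA x) := by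
  rw [norm_sq_polyOp_eq_integral hA]
  refine integral_congr_ae ?_
  filter_upwards [measure_eq_zero_iff_ae_notMem.1 ((mem_spectralSubspace hA).1 hx)] with t ht
  have ht' : t ∉ S := by simpa using ht
  simp [ht']

/-- Heuristically `⟨a, b⟩ = ⟨1_S(A)a, b⟩ = ⟨a, 1_S(A)b⟩ = 0`, with a polynomial in place of the
indicator. -/
theorem inner_eq_zero_of_mem_spectralSubspace {S : Set ℝ} (hS : MeasurableSet S) {a b : H}
    (ha : a ∈ spectralSubspace hA S) (hb : b ∈ spectralSubspace hA Sᶜ) : inner 𝕜 a b = 0 := by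
  have hs := momentMeasure_compl_Icc hA
  have hle : ∀ ε : ℝ, 0 < ε → ‖inner 𝕜 a b‖ ≤ ε * (‖a‖ + ‖b‖) := fun ε hε => by
    -- Approximating for the sum of the two measures gives one `p` that serves both vectors.
    obtain ⟨p, hi, hp⟩ := exists_polynomial_integral_sq_le (r := ‖A‖)
      (μ := momentMeasure hA a + momentMeasure hA b) (by simp [hs]) hS (sq_pos_of_pos hε)
    obtain ⟨hia, hib⟩ := integrable_add_measure.1 hi
    rw [integral_add_measure hia hib, ← norm_sq_polyOp_sub_self hA ha,
      ← norm_sq_polyOp_of_mem_compl hA hb] at hp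
    have h1 : ‖polyOp A p a - a‖ ≤ ε :=
      abs_le_of_sq_le_sq' (by nlinarith [sq_nonneg ‖polyOp A p b‖]) hε.le |>.2
    have h2 : ‖polyOp A p b‖ ≤ ε :=
      abs_le_of_sq_le_sq' (by nlinarith [sq_nonneg ‖polyOp A p a - a‖]) hε.le |>.2
    have h3 : inner 𝕜 a b = inner 𝕜 a (polyOp A p b) - inner 𝕜 (polyOp A p a - a) b := by
      rw [inner_sub_left, polyOp_inner_left hA]; ring
    calc ‖inner 𝕜 a b‖ ≤ ‖inner 𝕜 a (polyOp A p b)‖ + ‖inner 𝕜 (polyOp A p a - a) b‖ := by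
          rw [h3]; exact norm_sub_le _ _
      _ ≤ ‖a‖ * ‖polyOp A p b‖ + ‖polyOp A p a - a‖ * ‖b‖ :=
          add_le_add (norm_inner_le_norm _ _) (norm_inner_le_norm _ _)
      _ ≤ ‖a‖ * ε + ε * ‖b‖ := by gcongr
      _ = ε * (‖a‖ + ‖b‖) := by ring
  rw [← norm_le_zero_iff]
  refine le_of_forall_pos_le_add fun δ hδ => ?_
  have h := hle (δ / (‖a‖ + ‖b‖ + 1)) (by positivity)
  refine h.trans ?_
  rw [zero_add, div_mul_eq_mul_div, div_le_iff₀ (by positivity)]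
  nlinarith

/-- Bounds the mass that an approximant leaves on the wrong side: applied with `f = p` on `Sᶜ` and
`f = 1 - p` on `S`. -/
theorem lintegral_restrict_le_of_eqOn {S R : Set ℝ} (hR : MeasurableSet R) {f g : ℝ → ℝ}
    {μ : Measure ℝ} (hfg : ∀ t ∈ R, f t ^ 2 = (g t - S.indicator 1 t) ^ 2)
    (hg : Integrable (fun t => (g t - S.indicator 1 t) ^ 2) μ) :
    ∫⁻ t in R, ENNReal.ofReal (f t ^ 2) ∂μ ≤
      ENNReal.ofReal (∫ t, (g t - S.indicator 1 t) ^ 2 ∂μ) := by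
  rw [ofReal_integral_eq_lintegral_ofReal hg (ae_of_all _ fun t => sq_nonneg _)]
  refine le_trans (le_of_eq ?_) (setLIntegral_le_lintegral R _)
  exact setLIntegral_congr_fun hR fun t ht => by simp only [hfg t ht]

/-- Polynomials tending to the indicator of `S` in mean square give a Cauchy sequence `p n (A) x`,
whose limit plays the role of `1_S(A)x`. By the density formula the masses of `p n (A) x` off `S`
and of `x - p n (A) x` on `S` tend to zero. -/
theorem exists_spectral_decomposition {S : Set ℝ} (hS : MeasurableSet S) (x : H) :
    ∃ (p : ℕ → ℝ[X]) (z : H), Tendsto (fun n => polyOp A (p n) x) atTop (𝓝 z) ∧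
      z ∈ spectralSubspace hA S ∧ x - z ∈ spectralSubspace hA Sᶜ := by
  have hs := momentMeasure_compl_Icc hA x
  choose p hi hp using fun n : ℕ =>
    exists_polynomial_integral_sq_le hs hS (Nat.one_div_pos_of_nat (α := ℝ) (n := n))
  have hdiff : ∀ n m N, N ≤ n → N ≤ m →
      dist (polyOp A (p n) x) (polyOp A (p m) x) ≤ √(4 * (1 / ((N : ℝ) + 1))) := by
    intro n m N hn hm
    rw [dist_eq_norm]
    refine Real.le_sqrt_of_sq_le ?_
    have h1 : polyOp A (p n) x - polyOp A (p m) x = polyOp A (p n - p m) x := by simp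
    rw [h1, norm_sq_polyOp_eq_integral hA]
    have hn' : ∫ t, ((p n).eval t - S.indicator 1 t) ^ 2 ∂(momentMeasure hA x) ≤
        1 / ((N : ℝ) + 1) := (hp n).trans (Nat.one_div_le_one_div hn)
    have hm' : ∫ t, ((p m).eval t - S.indicator 1 t) ^ 2 ∂(momentMeasure hA x) ≤
        1 / ((N : ℝ) + 1) := (hp m).trans (Nat.one_div_le_one_div hm)
    calc ∫ t, (p n - p m).eval t ^ 2 ∂(momentMeasure hA x)
        ≤ ∫ t, (2 * ((p n).eval t - S.indicator 1 t) ^ 2 +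
            2 * ((p m).eval t - S.indicator 1 t) ^ 2) ∂(momentMeasure hA x) := by
          refine integral_mono (integrable_of_continuous_of_compl_Icc hs (by fun_prop))
            (((hi n).const_mul 2).add ((hi m).const_mul 2)) fun t => ?_
          simp only [eval_sub]
          nlinarith [sq_nonneg ((p n).eval t - S.indicator 1 t +
            ((p m).eval t - S.indicator 1 t))]
      _ ≤ 4 * (1 / ((N : ℝ) + 1)) := by
          rw [integral_add ((hi n).const_mul 2) ((hi m).const_mul 2), integral_const_mul,
            integral_const_mul]
          linarith
  have h0 : Tendsto (fun n : ℕ => 1 / ((n : ℝ) + 1)) atTop (𝓝 0) :=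
    tendsto_one_div_add_atTop_nhds_zero_nat
  have hcauchy : CauchySeq fun n => polyOp A (p n) x := by
    refine cauchySeq_of_le_tendsto_0 _ hdiff ?_
    simpa using (h0.const_mul 4).sqrt
  obtain ⟨z, hz⟩ := cauchySeq_tendsto_of_complete hcauchy
  have h1 : Tendsto (fun n => ENNReal.ofReal
      (∫ t, ((p n).eval t - S.indicator 1 t) ^ 2 ∂(momentMeasure hA x))) atTop (𝓝 0) := by
    have := squeeze_zero (fun n => integral_nonneg fun t => sq_nonneg _) hp h0
    simpa using ENNReal.tendsto_ofReal this
  refine ⟨p, z, hz, ?_, ?_⟩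
  · refine momentMeasure_eq_zero_of_tendsto hA hz
      (tendsto_of_tendsto_of_tendsto_of_le_of_le tendsto_const_nhds h1 (fun n => zero_le)
        fun n => ?_)
    rw [momentMeasure_polyOp, withDensity_apply _ hS.compl]
    refine lintegral_restrict_le_of_eqOn hS.compl (fun t ht => ?_) (hi n)
    simp [Set.indicator_of_notMem ht]
  · have hz' : Tendsto (fun n => polyOp A (1 - p n) x) atTop (𝓝 (x - z)) := by
      simpa using (tendsto_const_nhds (x := x)).sub hz
    rw [mem_spectralSubspace, compl_compl]
    refine momentMeasure_eq_zero_of_tendsto hA hz'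
      (tendsto_of_tendsto_of_tendsto_of_le_of_le tendsto_const_nhds h1 (fun n => zero_le)
        fun n => ?_)
    rw [momentMeasure_polyOp, withDensity_apply _ hS]
    refine lintegral_restrict_le_of_eqOn hS (fun t ht => ?_) (hi n)
    simp only [eval_sub, eval_one, Set.indicator_of_mem ht, Pi.one_apply]
    ring

/-- The spectral projection of `A` attached to a Borel set. -/
noncomputable def spectralProj (S : Set ℝ) : H →L[𝕜] H :=
  (spectralSubspace hA S).starProjection

theorem spectralProj_mem (S : Set ℝ) (x : H) : spectralProj hA S x ∈ spectralSubspace hA S :=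
  Submodule.starProjection_apply_mem _ _

theorem spectralProj_eq_of_mem {S : Set ℝ} (hS : MeasurableSet S) {x z : H}
    (hz : z ∈ spectralSubspace hA S) (hxz : x - z ∈ spectralSubspace hA Sᶜ) :
    spectralProj hA S x = z := by
  refine Submodule.eq_starProjection_of_mem_of_inner_eq_zero hz fun w hw => ?_
  rw [← inner_conj_symm, inner_eq_zero_of_mem_spectralSubspace hA hS hw hxz, map_zero]

theorem sub_spectralProj_mem {S : Set ℝ} (hS : MeasurableSet S) (x : H) :
    x - spectralProj hA S x ∈ spectralSubspace hA Sᶜ := by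
  obtain ⟨p, z, -, hz, hxz⟩ := exists_spectral_decomposition hA hS x
  rwa [spectralProj_eq_of_mem hA hS hz hxz]

/-- The projection of `x` is a limit of polynomials in `A` applied to `x`, and these preserve the
closed subspace of `T`. This yields multiplicativity. -/
theorem spectralProj_mem_of_mem {S T : Set ℝ} (hS : MeasurableSet S) {x : H}
    (hx : x ∈ spectralSubspace hA T) : spectralProj hA S x ∈ spectralSubspace hA T := by
  obtain ⟨p, z, hp, hz, hxz⟩ := exists_spectral_decomposition hA hS x
  rw [spectralProj_eq_of_mem hA hS hz hxz]
  exact (isClosed_spectralSubspace hA T).mem_of_tendsto hp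
    (Eventually.of_forall fun n => polyOp_mem_spectralSubspace hA _ hx)

theorem spectralSubspace_mono {S T : Set ℝ} (h : S ⊆ T) :
    spectralSubspace hA S ≤ spectralSubspace hA T := fun _ hx =>
  measure_mono_null (Set.compl_subset_compl.2 h) hx

theorem spectralProj_inter {S T : Set ℝ} (hS : MeasurableSet S) (hT : MeasurableSet T) :
    spectralProj hA (S ∩ T) = spectralProj hA S * spectralProj hA T := by
  ext x
  refine spectralProj_eq_of_mem hA (hS.inter hT) ?_ ?_
  · rw [spectralSubspace_inter]
    exact ⟨spectralProj_mem hA _ _, spectralProj_mem_of_mem hA hS (spectralProj_mem hA _ _)⟩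
  · have h1 := spectralSubspace_mono hA (Set.compl_subset_compl.2 (Set.inter_subset_right (s := S)))
      (sub_spectralProj_mem hA hT x)
    have h2 := spectralSubspace_mono hA (Set.compl_subset_compl.2 (Set.inter_subset_left (t := T)))
      (sub_spectralProj_mem hA hS (spectralProj hA T x))
    have h3 := Submodule.add_mem _ h1 h2
    rwa [sub_add_sub_cancel] at h3

/-- The measure of `x` is the sum of those of its two components; one is null on `S`, the other has
all its mass there. -/
theorem norm_sq_spectralProj {S : Set ℝ} (hS : MeasurableSet S) (x : H) :
    ENNReal.ofReal (‖spectralProj hA S x‖ ^ 2) = momentMeasure hA x S := by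
  have h1 := momentMeasure_add_of_inner_eq_zero hA (x := spectralProj hA S x)
    (y := x - spectralProj hA S x) fun p => inner_eq_zero_of_mem_spectralSubspace hA hS
      (spectralProj_mem hA S x) (polyOp_mem_spectralSubspace hA p (sub_spectralProj_mem hA hS x))
  rw [add_sub_cancel] at h1
  have h2 := (mem_spectralSubspace hA).1 (sub_spectralProj_mem hA hS x)
  rw [compl_compl] at h2
  rw [h1, Measure.add_apply, h2, add_zero, ← momentMeasure_univ hA,
    ← measure_add_measure_compl hS, (mem_spectralSubspace hA).1 (spectralProj_mem hA S x), add_zero]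

theorem spectralProj_empty : spectralProj hA ∅ = 0 := by
  ext x
  have h := norm_sq_spectralProj hA MeasurableSet.empty x
  simpa using h

theorem spectralProj_union {S T : Set ℝ} (hS : MeasurableSet S) (hT : MeasurableSet T)
    (h : Disjoint S T) (x : H) :
    spectralProj hA (S ∪ T) x = spectralProj hA S x + spectralProj hA T x := by
  refine spectralProj_eq_of_mem hA (hS.union hT) ?_ ?_
  · exact Submodule.add_mem _
      (spectralSubspace_mono hA Set.subset_union_left (spectralProj_mem hA S x))
      (spectralSubspace_mono hA Set.subset_union_right (spectralProj_mem hA T x))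
  · rw [Set.compl_union, spectralSubspace_inter]
    constructor
    · rw [← sub_sub]
      exact Submodule.sub_mem _ (sub_spectralProj_mem hA hS x)
        (spectralSubspace_mono hA h.symm.subset_compl_right (spectralProj_mem hA T x))
    · rw [add_comm, ← sub_sub]
      exact Submodule.sub_mem _ (sub_spectralProj_mem hA hT x)
        (spectralSubspace_mono hA h.subset_compl_right (spectralProj_mem hA S x))

theorem spectralProj_biUnion_finset {S : ℕ → Set ℝ} (hS : ∀ n, MeasurableSet (S n))
    (hd : Pairwise (Function.onFun Disjoint S)) (F : Finset ℕ) (x : H) :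
    spectralProj hA (⋃ n ∈ F, S n) x = ∑ n ∈ F, spectralProj hA (S n) x := by
  classical
  induction F using Finset.induction_on with
  | empty => simp [spectralProj_empty]
  | insert a F ha ih =>
    rw [Finset.set_biUnion_insert, Finset.sum_insert ha, ← ih,
      spectralProj_union hA (hS a) (Finset.measurableSet_biUnion F fun n _ => hS n)]
    rw [Set.disjoint_iUnion₂_right]
    exact fun n hn => hd fun h => ha (h ▸ hn)

theorem hasSum_spectralProj {S : ℕ → Set ℝ} (hS : ∀ n, MeasurableSet (S n))
    (hd : Pairwise (Function.onFun Disjoint S)) (x : H) :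
    HasSum (fun n => spectralProj hA (S n) x) (spectralProj hA (⋃ n, S n) x) := by
  have hU := MeasurableSet.iUnion hS
  have hF : ∀ F : Finset ℕ, MeasurableSet (⋃ n ∈ F, S n) :=
    fun F => Finset.measurableSet_biUnion F fun n _ => hS n
  have h1 : HasSum (fun n => momentMeasure hA x (S n)) (momentMeasure hA x (⋃ n, S n)) := by
    rw [measure_iUnion hd hS]
    exact ENNReal.summable.hasSum
  have hsub : ∀ F : Finset ℕ, (⋃ n ∈ F, S n) ⊆ ⋃ n, S n :=
    fun F => Set.iUnion₂_subset fun n _ => Set.subset_iUnion S n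
  -- The error is the projection of the uncovered part of the union, so its squared norm is the mass
  -- of that part.
  have key : ∀ F : Finset ℕ,
      ‖∑ n ∈ F, spectralProj hA (S n) x - spectralProj hA (⋃ n, S n) x‖ ^ 2 =
        (momentMeasure hA x (⋃ n, S n)).toReal - (∑ n ∈ F, momentMeasure hA x (S n)).toReal := by
    intro F
    have h2 := spectralProj_union hA (hF F) (hU.diff (hF F)) Set.disjoint_sdiff_right x
    rw [Set.union_sdiff_cancel (hsub F), spectralProj_biUnion_finset hA hS hd] at h2
    rw [h2, sub_add_cancel_left, norm_neg, ← measure_biUnion_finset (fun i _ j _ h => hd h)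
      fun n _ => hS n, ← measureReal_def, ← measureReal_def, ← measureReal_sdiff (hsub F) (hF F),
      measureReal_def, ← norm_sq_spectralProj hA (hU.diff (hF F)),
      ENNReal.toReal_ofReal (sq_nonneg _)]
  have h3 : Tendsto (fun F : Finset ℕ =>
      ‖∑ n ∈ F, spectralProj hA (S n) x - spectralProj hA (⋃ n, S n) x‖ ^ 2) atTop (𝓝 0) := by
    simp_rw [key]
    have h4 := (ENNReal.tendsto_toReal (measure_ne_top (momentMeasure hA x) (⋃ n, S n))).comp h1
    simpa using (tendsto_const_nhds (x := (momentMeasure hA x (⋃ n, S n)).toReal)).sub h4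
  rw [HasSum, tendsto_iff_norm_sub_tendsto_zero]
  simpa using h3.sqrt

/-- The projection-valued spectral measure of a bounded self-adjoint operator. -/
noncomputable def spectralPVM : ProjValuedMeasure 𝕜 H where
  proj := spectralProj hA
  isStarProjection S _ := isStarProjection_starProjection
  empty := spectralProj_empty hA
  univ := by
    ext x
    refine spectralProj_eq_of_mem hA MeasurableSet.univ ?_ ?_ <;> simp [mem_spectralSubspace]
  inter S T hS hT := spectralProj_inter hA hS hT
  hasSum_iUnion S hS hd x := hasSum_spectralProj hA hS hd x

theorem scalarMeasure_spectralPVM (x : H) :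
    (spectralPVM hA).scalarMeasure x = momentMeasure hA x := by
  ext S hS
  rw [ProjValuedMeasure.scalarMeasure_apply _ _ hS]
  exact norm_sq_spectralProj hA hS x

/-- The spectral theorem for bounded self-adjoint operators. -/
theorem isSpectralMeasure_spectralPVM : IsSpectralMeasure A (spectralPVM hA) where
  isSelfAdjoint := hA
  integrable x := by
    rw [scalarMeasure_spectralPVM]
    exact integrable_of_continuous_of_compl_Icc (momentMeasure_compl_Icc hA x) continuous_id
  inner_eq x := by
    have h := integral_eval_momentMeasure hA x X
    simp only [eval_X, polyOp_X] at h
    rw [scalarMeasure_spectralPVM, h]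
    exact ((ContinuousLinearMap.isSelfAdjoint_iff_isSymmetric.1 hA).coe_re_inner_self_apply x).symm

end SpectralTheorem

/-! ### Positive operators: support of the spectral measures, square root, and a large spectral
subspace. -/

section PositiveOperators

open Polynomial

variable {𝕜 H : Type*} [RCLike 𝕜] [NormedAddCommGroup H] [InnerProductSpace 𝕜 H]
  [CompleteSpace H] {A : H →L[𝕜] H}

theorem momentMeasure_real_univ (hA : IsSelfAdjoint A) (x : H) :
    (momentMeasure hA x).real Set.univ = ‖x‖ ^ 2 := by
  rw [measureReal_def, momentMeasure_univ, ENNReal.toReal_ofReal (sq_nonneg _)]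

theorem re_inner_eq_integral (hA : IsSelfAdjoint A) (x : H) :
    RCLike.re (inner 𝕜 x (A x)) = ∫ t, t ∂(momentMeasure hA x) := by
  have h := integral_eval_momentMeasure hA x X
  simp only [eval_X, polyOp_X] at h
  exact h.symm

theorem integrable_id_momentMeasure (hA : IsSelfAdjoint A) (x : H) :
    Integrable (fun t : ℝ => t) (momentMeasure hA x) :=
  integrable_of_continuous_of_compl_Icc (momentMeasure_compl_Icc hA x) continuous_id

theorem mul_norm_sq_le_re_inner (hA : IsSelfAdjoint A) {c : ℝ} {x : H}
    (hx : x ∈ spectralSubspace hA (Set.Ioi c)) :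
    c * ‖x‖ ^ 2 ≤ RCLike.re (inner 𝕜 x (A x)) := by
  rw [re_inner_eq_integral hA, ← momentMeasure_real_univ hA]
  have h : ∫ _, c ∂(momentMeasure hA x) ≤ ∫ t, t ∂(momentMeasure hA x) := by
    refine integral_mono_ae (integrable_const c) (integrable_id_momentMeasure hA x) ?_
    filter_upwards [measure_eq_zero_iff_ae_notMem.1 ((mem_spectralSubspace hA).1 hx)] with t ht
    exact (by simpa using ht : c < t).le
  rwa [integral_const, smul_eq_mul, mul_comm] at h

/-- A vector `y` in the subspace of `(-∞, 0)` has `∫ t ≥ 0` by positivity although `t < 0` almost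
everywhere, so `y = 0`. -/
theorem momentMeasure_Iio_zero (hA : A.IsPositive) (x : H) :
    momentMeasure hA.isSelfAdjoint x (Set.Iio 0) = 0 := by
  have h0 : ∀ y ∈ spectralSubspace hA.isSelfAdjoint (Set.Iio 0), y = 0 := by
    intro y hy
    have hae := measure_eq_zero_iff_ae_notMem.1 ((mem_spectralSubspace _).1 hy)
    have h1 : 0 ≤ ∫ t, t ∂(momentMeasure hA.isSelfAdjoint y) := by
      rw [← re_inner_eq_integral]
      exact hA.re_inner_nonneg_right y
    have h2 : ∫ t, -t ∂(momentMeasure hA.isSelfAdjoint y) = 0 := by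
      refine le_antisymm (by rw [integral_neg]; linarith) (integral_nonneg_of_ae ?_)
      filter_upwards [hae] with t ht
      have : t < 0 := by simpa using ht
      simpa using this.le
    have hi : Integrable (fun t : ℝ => -t) (momentMeasure hA.isSelfAdjoint y) :=
      (integrable_id_momentMeasure _ y).neg
    rw [integral_eq_zero_iff_of_nonneg_ae _ hi] at h2
    · have h3 : ∀ᵐ _ ∂(momentMeasure hA.isSelfAdjoint y), False := by
        filter_upwards [hae, h2] with t ht ht2
        have : t < 0 := by simpa using ht
        have : t = 0 := by simpa using ht2
        linarith
      have h4 := momentMeasure_real_univ hA.isSelfAdjoint y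
      have h5 : momentMeasure hA.isSelfAdjoint y Set.univ = 0 := by
        simpa [ae_iff] using h3
      rw [measureReal_def, h5] at h4
      simpa using h4.symm
    · filter_upwards [hae] with t ht
      have : t < 0 := by simpa using ht
      simpa using this.le
  rw [← norm_sq_spectralProj _ measurableSet_Iio, h0 _ (spectralProj_mem _ _ _)]
  simp

theorem momentMeasure_compl_Icc_zero (hA : A.IsPositive) (x : H) :
    momentMeasure hA.isSelfAdjoint x (Set.Icc 0 ‖A‖)ᶜ = 0 := by
  refine measure_mono_null (t := Set.Iio 0 ∪ (Set.Icc (-‖A‖) ‖A‖)ᶜ) ?_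
    (measure_union_null (momentMeasure_Iio_zero hA x) (momentMeasure_compl_Icc _ x))
  intro t ht
  by_contra h
  simp only [Set.mem_union, Set.mem_Iio, Set.mem_compl_iff, Set.mem_Icc, not_or, not_lt,
    not_not] at h
  exact ht ⟨h.1, h.2.2⟩

theorem norm_polyOp_apply_le (hA : IsSelfAdjoint A) {x : H} {S : Set ℝ}
    (hS : momentMeasure hA x Sᶜ = 0) {p : ℝ[X]} {c : ℝ} (hc0 : 0 ≤ c)
    (hc : ∀ t ∈ S, |p.eval t| ≤ c) : ‖polyOp A p x‖ ≤ c * ‖x‖ := by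
  refine abs_le_of_sq_le_sq' ?_ (by positivity) |>.2
  rw [norm_sq_polyOp_eq_integral hA, mul_pow, ← momentMeasure_real_univ hA]
  refine (Real.le_norm_self _).trans (norm_integral_le_of_norm_le_const ?_)
  filter_upwards [measure_eq_zero_iff_ae_notMem.1 hS] with t ht
  rw [Real.norm_of_nonneg (sq_nonneg _), ← sq_abs]
  gcongr
  exact hc t (by simpa using ht)

theorem norm_polyOp_le (hA : A.IsPositive) {p : ℝ[X]} {c : ℝ} (hc0 : 0 ≤ c)
    (hc : ∀ t ∈ Set.Icc 0 ‖A‖, |p.eval t| ≤ c) : ‖polyOp A p‖ ≤ c :=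
  ContinuousLinearMap.opNorm_le_bound _ hc0 fun x =>
    norm_polyOp_apply_le hA.isSelfAdjoint (momentMeasure_compl_Icc_zero hA x) hc0 hc

/-- A positive operator on a real or complex Hilbert space has a self-adjoint square root. -/
theorem exists_isSelfAdjoint_mul_self_eq (hA : A.IsPositive) :
    ∃ R : H →L[𝕜] H, IsSelfAdjoint R ∧ R * R = A := by
  choose p hp using fun n : ℕ => exists_polynomial_near_of_continuousOn 0 ‖A‖ Real.sqrt
    Real.continuous_sqrt.continuousOn _ (Nat.one_div_pos_of_nat (α := ℝ) (n := n))
  have h0 : Tendsto (fun n : ℕ => 1 / ((n : ℝ) + 1)) atTop (𝓝 0) :=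
    tendsto_one_div_add_atTop_nhds_zero_nat
  have hdist : ∀ n m N, N ≤ n → N ≤ m →
      dist (polyOp A (p n)) (polyOp A (p m)) ≤ 2 * (1 / ((N : ℝ) + 1)) := by
    intro n m N hn hm
    rw [dist_eq_norm, ← map_sub]
    refine norm_polyOp_le hA (by positivity) fun t ht => ?_
    have h1 := (hp n t ht).le.trans (Nat.one_div_le_one_div (α := ℝ) hn)
    have h2 := (hp m t ht).le.trans (Nat.one_div_le_one_div (α := ℝ) hm)
    rw [eval_sub, abs_le] at *
    constructor <;> linarith [h1.1, h1.2, h2.1, h2.2]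
  obtain ⟨R, hR⟩ := cauchySeq_tendsto_of_complete
    (cauchySeq_of_le_tendsto_0 _ hdist (by simpa using h0.const_mul 2))
  refine ⟨R, ?_, ?_⟩
  · refine tendsto_nhds_unique hR.star ?_
    simpa only [(polyOp_isSelfAdjoint hA.isSelfAdjoint (p _)).star_eq] using hR
  · refine tendsto_nhds_unique (hR.mul hR) ?_
    rw [tendsto_iff_norm_sub_tendsto_zero]
    -- Factor `p² - t = (p - √t)(p + √t)`; the second factor is at most `2√t + 1` in absolute value.
    refine squeeze_zero (fun n => norm_nonneg _) (g := fun n : ℕ =>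
      1 / ((n : ℝ) + 1) * (2 * √‖A‖ + 1)) (fun n => ?_) (by simpa using h0.mul_const _)
    have h1 : polyOp A (p n) * polyOp A (p n) - A = polyOp A (p n * p n - X) := by
      simp [polyOp_X]
    rw [h1]
    refine norm_polyOp_le hA (by positivity) fun t ht => ?_
    have h2 := (hp n t ht).le
    have h3 : eval t (p n * p n - X) = (eval t (p n) - √t) * (eval t (p n) + √t) := by
      rw [eval_sub, eval_mul, eval_X]
      nlinarith [Real.mul_self_sqrt ht.1]
    rw [h3, abs_mul]
    have h4 : √t ≤ √‖A‖ := Real.sqrt_le_sqrt ht.2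
    have h5 : 1 / ((n : ℝ) + 1) ≤ 1 := by
      rw [div_le_one (by positivity)]
      linarith [Nat.cast_nonneg (α := ℝ) n]
    gcongr
    rw [abs_le] at h2 ⊢
    have := Real.sqrt_nonneg t
    constructor <;> linarith [h2.1, h2.2]

/-- If all nonzero spectral projections of the positive operator `A` have infinite rank and
`1 < ‖A‖`, then `A` is bounded below by a constant greater than `1` on an infinite-dimensional
subspace. -/
theorem exists_infinite_subspace_bounded_below (hA : A.IsPositive)
    (hspec : ∀ P : H →L[𝕜] H, IsSpectralProjection A P → P ≠ 0 → HasInfiniteRank P)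
    (hnorm : 1 < ‖A‖) :
    ∃ ε : ℝ, 0 < ε ∧ ∃ M : Submodule 𝕜 H, ¬ FiniteDimensional 𝕜 M ∧
      ∀ x ∈ M, (1 + ε) * ‖x‖ ^ 2 ≤ RCLike.re (inner 𝕜 x (A x)) := by
  obtain ⟨c, hc1, hc2⟩ := exists_between hnorm
  refine ⟨c - 1, by linarith, LinearMap.range (spectralProj hA.isSelfAdjoint (Set.Ioi c) : H →ₗ[𝕜] H),
    ?_, ?_⟩
  · refine hspec _ ⟨spectralPVM hA.isSelfAdjoint, isSpectralMeasure_spectralPVM _, Set.Ioi c,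
      measurableSet_Ioi, rfl⟩ fun h => ?_
    -- If the projection vanished, every spectral measure would live on `[0, c]`, forcing `‖A‖ ≤ c`.
    refine hc2.not_ge (ContinuousLinearMap.opNorm_le_bound _ (by linarith) fun x => ?_)
    have hx : momentMeasure hA.isSelfAdjoint x (Set.Ioi c) = 0 := by
      rw [← norm_sq_spectralProj _ measurableSet_Ioi, h]
      simp
    have hx' : momentMeasure hA.isSelfAdjoint x (Set.Icc 0 c)ᶜ = 0 := by
      refine measure_mono_null (t := Set.Iio 0 ∪ Set.Ioi c) ?_
        (measure_union_null (momentMeasure_Iio_zero hA x) hx)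
      intro t ht
      by_contra h
      simp only [Set.mem_union, Set.mem_Iio, Set.mem_Ioi, not_or, not_lt] at h
      exact ht h
    have := norm_polyOp_apply_le hA.isSelfAdjoint hx' (p := X) (c := c) (by linarith) fun t ht => by
      rw [eval_X, abs_of_nonneg ht.1]
      exact ht.2
    rwa [polyOp_X] at this
  · rintro _ ⟨x, rfl⟩
    rw [add_sub_cancel]
    exact mul_norm_sq_le_re_inner _ (spectralProj_mem _ _ x)

end PositiveOperators

/-! ### Orthonormal families split into classes on which a symmetric form vanishes. -/

section IsotropicFamilies

variable {𝕜 K : Type*} [RCLike 𝕜] [NormedAddCommGroup K] [InnerProductSpace 𝕜 K]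

/-- A set of labelled vectors which is orthonormal and on which the quadratic form of `S` vanishes
between any two vectors with the same label. -/
structure IsIsotropicFamily (S : K →L[𝕜] K) (U : Set (ℕ × K)) : Prop where
  norm_eq : ∀ p ∈ U, ‖p.2‖ = 1
  inner_eq : ∀ p ∈ U, ∀ q ∈ U, p ≠ q → inner 𝕜 p.2 q.2 = 0
  isotropic : ∀ p ∈ U, ∀ q ∈ U, p.1 = q.1 → inner 𝕜 p.2 (S q.2) = 0

variable {S : K →L[𝕜] K} (hS : ∀ x y, inner 𝕜 (S x) y = inner 𝕜 x (S y))

include hS in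
theorem IsIsotropicFamily.insert {U : Set (ℕ × K)} (hU : IsIsotropicFamily S U) {j : ℕ} {w : K}
    (hw : ‖w‖ = 1) (hperp : ∀ p ∈ U, inner 𝕜 p.2 w = 0) (hq : inner 𝕜 w (S w) = 0)
    (hj : ∀ p ∈ U, p.1 = j → inner 𝕜 p.2 (S w) = 0) :
    IsIsotropicFamily S (insert (j, w) U) where
  norm_eq := by
    rintro p (rfl | hp)
    exacts [hw, hU.norm_eq p hp]
  inner_eq := by
    rintro p (rfl | hp) q (rfl | hq') hpq
    · exact absurd rfl hpq
    · exact inner_eq_zero_symm.1 (hperp q hq')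
    · exact hperp p hp
    · exact hU.inner_eq p hp q hq' hpq
  isotropic := by
    rintro p (rfl | hp) q (rfl | hq') hpq
    · exact hq
    · rw [← hS]
      exact inner_eq_zero_symm.1 (hj q hq' hpq.symm)
    · exact hj p hp hpq
    · exact hU.isotropic p hp q hq' hpq

theorem norm_rotation {a b : K} (ha : ‖a‖ = 1) (hb : ‖b‖ = 1) (hab : inner 𝕜 a b = 0) {c s : ℝ}
    (hcs : c ^ 2 + s ^ 2 = 1) : ‖(c : 𝕜) • a + (s : 𝕜) • b‖ = 1 := by
  have h : ‖(c : 𝕜) • a + (s : 𝕜) • b‖ ^ 2 = 1 := by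
    rw [@norm_add_sq 𝕜, inner_smul_left, inner_smul_right, hab, norm_smul, norm_smul, ha, hb,
      RCLike.norm_ofReal, RCLike.norm_ofReal]
    simpa using hcs
  exact (pow_eq_one_iff_of_nonneg (norm_nonneg _) two_ne_zero).1 h

include hS in
theorem inner_rotation {a b : K} (hab : inner 𝕜 a (S b) = 0) {α β : ℝ}
    (ha : inner 𝕜 a (S a) = (α : 𝕜)) (hb : inner 𝕜 b (S b) = (β : 𝕜)) (c s : ℝ) :
    inner 𝕜 ((c : 𝕜) • a + (s : 𝕜) • b) (S ((c : 𝕜) • a + (s : 𝕜) • b)) =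
      ((c ^ 2 * α + s ^ 2 * β : ℝ) : 𝕜) := by
  have hba : inner 𝕜 b (S a) = 0 := by rw [← hS]; exact inner_eq_zero_symm.1 hab
  simp only [map_add, map_smul, inner_add_left, inner_add_right, inner_smul_left,
    inner_smul_right, hab, hba, ha, hb, RCLike.conj_ofReal]
  push_cast
  ring

include hS in
theorem inner_self_apply_eq_ofReal (x : K) :
    inner 𝕜 x (S x) = ((RCLike.re (inner 𝕜 x (S x)) : ℝ) : 𝕜) := by
  refine (RCLike.conj_eq_iff_re.1 ?_).symm
  rw [inner_conj_symm, hS]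

include hS in
/-- If the quadratic form of `S` takes values above `ε` and below `-ε` on unit vectors of every
subspace of finite codimension, it takes all values between on these. -/
theorem exists_unit_inner_eq {ε : ℝ} (hε : 0 < ε)
    (hpos : ∀ F : Submodule 𝕜 K, FiniteDimensional 𝕜 F →
      ∃ w ∈ Fᗮ, ‖w‖ = 1 ∧ ε ≤ RCLike.re (inner 𝕜 w (S w)))
    (hneg : ∀ F : Submodule 𝕜 K, FiniteDimensional 𝕜 F →
      ∃ w ∈ Fᗮ, ‖w‖ = 1 ∧ RCLike.re (inner 𝕜 w (S w)) ≤ -ε)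
    (F : Submodule 𝕜 K) (hF : FiniteDimensional 𝕜 F) {d : ℝ} (hd : |d| ≤ ε) :
    ∃ w ∈ Fᗮ, ‖w‖ = 1 ∧ inner 𝕜 w (S w) = (d : 𝕜) := by
  obtain ⟨a, haF, ha, hqa⟩ := hpos F hF
  -- Orthogonality of `b` to both `a` and `S a` removes the cross terms, so unit combinations
  -- realise all convex combinations of `α` and `β`.
  obtain ⟨b, hbF, hb, hqb⟩ := hneg (F ⊔ Submodule.span 𝕜 {a, S a})
    (by have := FiniteDimensional.span_of_finite 𝕜 (Set.toFinite {a, S a}); infer_instance)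
  set α := RCLike.re (inner 𝕜 a (S a)) with hα
  set β := RCLike.re (inner 𝕜 b (S b)) with hβ
  obtain ⟨hd1, hd2⟩ := abs_le.1 hd
  have hab : inner 𝕜 a b = 0 := hbF a
    (Submodule.mem_sup_right (Submodule.subset_span (by simp)))
  have hSab : inner 𝕜 a (S b) = 0 := by
    rw [← hS]
    exact hbF (S a) (Submodule.mem_sup_right (Submodule.subset_span (by simp)))
  have hαβ : 0 < α - β := by linarith
  have h1 : 0 ≤ (d - β) / (α - β) := div_nonneg (by linarith) hαβ.le
  have h2 : 0 ≤ (α - d) / (α - β) := div_nonneg (by linarith) hαβ.le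
  refine ⟨((√((d - β) / (α - β)) : ℝ) : 𝕜) • a + ((√((α - d) / (α - β)) : ℝ) : 𝕜) • b,
    Submodule.add_mem _ (Submodule.smul_mem _ _ haF) (Submodule.smul_mem _ _
      (Submodule.orthogonal_le le_sup_left hbF)), norm_rotation ha hb hab ?_, ?_⟩
  · rw [Real.sq_sqrt h1, Real.sq_sqrt h2]
    field_simp
    ring
  · rw [inner_rotation hS hSab (inner_self_apply_eq_ofReal hS a) (inner_self_apply_eq_ofReal hS b),
      Real.sq_sqrt h1, Real.sq_sqrt h2, ← hα, ← hβ]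
    congr 1
    field_simp
    ring

variable {ε : ℝ} (hε : 0 < ε) (hval : ∀ F : Submodule 𝕜 K, FiniteDimensional 𝕜 F → ∀ d : ℝ,
  |d| ≤ ε → ∃ w ∈ Fᗮ, ‖w‖ = 1 ∧ inner 𝕜 w (S w) = (d : 𝕜))

include hS hε hval in
theorem IsIsotropicFamily.exists_insert {U : Set (ℕ × K)} (hU : IsIsotropicFamily S U)
    (hfin : U.Finite) (j : ℕ) :
    ∃ w, (j, w) ∉ U ∧ IsIsotropicFamily S (Insert.insert (j, w) U) := by
  let F := Submodule.span 𝕜 (Prod.snd '' U ∪ S '' (Prod.snd '' U))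
  obtain ⟨w, hwF, hw, hq⟩ := hval F (FiniteDimensional.span_of_finite 𝕜
    ((hfin.image _).union ((hfin.image _).image _))) 0 (by simpa using hε.le)
  have h1 : ∀ p ∈ U, inner 𝕜 p.2 w = 0 := fun p hp =>
    hwF _ (Submodule.subset_span (Or.inl ⟨p, hp, rfl⟩))
  refine ⟨w, fun h => ?_, hU.insert hS hw h1 (by simpa using hq) fun p hp _ => ?_⟩
  · have hw0 : w = 0 := inner_self_eq_zero.1 (h1 _ h)
    simp [hw0] at hw
  · rw [← hS]
    exact hwF _ (Submodule.subset_span (Or.inr ⟨p.2, ⟨p, hp, rfl⟩, rfl⟩))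

include hS in
-- A fresh label imposes no condition on `S w` against the old vectors.
theorem IsIsotropicFamily.exists_insert_of_inner_eq_zero {U : Set (ℕ × K)}
    (hU : IsIsotropicFamily S U) (hfin : U.Finite) {w : K} (hw : ‖w‖ = 1)
    (hperp : ∀ p ∈ U, inner 𝕜 p.2 w = 0) (hq : inner 𝕜 w (S w) = 0) :
    ∃ j, IsIsotropicFamily S (Insert.insert (j, w) U) := by
  obtain ⟨j, hj⟩ := (hfin.image Prod.fst).exists_notMem
  exact ⟨j, hU.insert hS hw hperp hq fun p hp h => absurd ⟨p, hp, h⟩ hj⟩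

include hS hε hval in
-- Choose a unit vector `w` whose value `d` has sign opposite to `c`, and rotate in the plane of `e`
-- and `w`. The trace `c + d` is preserved, so if one new vector `u` has value zero, the other, `v`,
-- has value `c + d`, which satisfies the bound for `n`. Give `u` a fresh label and apply induction
-- to `v`; `e` is a combination of the two.
theorem IsIsotropicFamily.exists_mem_span_of_unit (n : ℕ) :
    ∀ {U : Set (ℕ × K)}, IsIsotropicFamily S U → U.Finite → ∀ {e : K}, ‖e‖ = 1 →
      (∀ p ∈ U, inner 𝕜 p.2 e = 0) → ∀ {c : ℝ}, inner 𝕜 e (S e) = (c : 𝕜) → |c| ≤ n * ε →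
      ∃ U', U ⊆ U' ∧ U'.Finite ∧ IsIsotropicFamily S U' ∧
        e ∈ Submodule.span 𝕜 (Prod.snd '' U') := by
  induction n with
  | zero =>
    intro U hU hfin e he hperp c hc hcn
    have hc0 : c = 0 := by simpa using hcn
    obtain ⟨j, hj⟩ := hU.exists_insert_of_inner_eq_zero hS hfin he hperp (by simp [hc, hc0])
    exact ⟨_, Set.subset_insert _ _, hfin.insert _, hj,
      Submodule.subset_span ⟨_, Set.mem_insert _ _, rfl⟩⟩
  | succ n ih =>
    intro U hU hfin e he hperp c hc hcn
    by_cases hc0 : c = 0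
    · exact ih hU hfin he hperp hc (by rw [hc0, abs_zero]; positivity)
    -- Here `|d| = min |c| ε` with sign opposite to `c`; the two quotients become the squared
    -- coefficients of the rotation.
    obtain ⟨d, hdε, hcd, hdc⟩ : ∃ d : ℝ, |d| ≤ ε ∧ |c + d| ≤ n * ε ∧
        0 < -d / (c - d) ∧ 0 < c / (c - d) := by
      push_cast at hcn
      have hn0 : 0 ≤ n * ε := by positivity
      obtain ⟨h1, h2⟩ := abs_le.1 hcn
      rcases lt_or_gt_of_ne hc0 with hc' | hc'
      · have hm : 0 < min (-c) ε := lt_min (by linarith) hε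
        refine ⟨min (-c) ε, by rw [abs_of_pos hm]; exact min_le_right _ _, ?_,
          div_pos_of_neg_of_neg (by linarith) (by linarith),
          div_pos_of_neg_of_neg (by linarith) (by linarith)⟩
        rw [abs_le]
        rcases min_cases (-c) ε with h | h <;> constructor <;> linarith
      · have hm : 0 < min c ε := lt_min (by linarith) hε
        refine ⟨-min c ε, by rw [abs_neg, abs_of_pos hm]; exact min_le_right _ _, ?_,
          div_pos (by linarith) (by linarith), div_pos (by linarith) (by linarith)⟩
        rw [abs_le]
        rcases min_cases c ε with h | h <;> constructor <;> linarith
    obtain ⟨w, hwF, hw, hqw⟩ := hval (Submodule.span 𝕜 (Prod.snd '' U ∪ {e, S e}))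
      (FiniteDimensional.span_of_finite 𝕜 ((hfin.image _).union (Set.toFinite _))) d hdε
    have hew : inner 𝕜 e w = 0 := hwF _ (Submodule.subset_span (by simp))
    have hSew : inner 𝕜 e (S w) = 0 := by
      rw [← hS]
      exact hwF _ (Submodule.subset_span (by simp))
    have hUw : ∀ p ∈ U, inner 𝕜 p.2 w = 0 := fun p hp =>
      hwF _ (Submodule.subset_span (Or.inl ⟨p, hp, rfl⟩))
    have hcd0 : c - d ≠ 0 := fun h => by simp [h] at hdc
    obtain ⟨x, y, hx, hy⟩ : ∃ x y : ℝ, x ^ 2 = -d / (c - d) ∧ y ^ 2 = c / (c - d) :=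
      ⟨_, _, Real.sq_sqrt hdc.1.le, Real.sq_sqrt hdc.2.le⟩
    have hxy : x ^ 2 + y ^ 2 = 1 := by rw [hx, hy]; field_simp; ring
    have hzero : x ^ 2 * c + y ^ 2 * d = 0 := by rw [hx, hy]; field_simp; ring
    have hsum : (-y) ^ 2 * c + x ^ 2 * d = c + d := by linear_combination (c + d) * hxy - hzero
    set u : K := (x : 𝕜) • e + (y : 𝕜) • w with hu
    set v : K := ((-y : ℝ) : 𝕜) • e + (x : 𝕜) • w with hv
    have hu1 : ‖u‖ = 1 := norm_rotation he hw hew hxy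
    have hv1 : ‖v‖ = 1 := norm_rotation he hw hew (by linarith [neg_sq y])
    have hqu : inner 𝕜 u (S u) = 0 := by
      rw [inner_rotation hS hSew hc hqw, hzero, RCLike.ofReal_zero]
    have hqv : inner 𝕜 v (S v) = ((c + d : ℝ) : 𝕜) := by
      rw [inner_rotation hS hSew hc hqw, hsum]
    have huv : inner 𝕜 u v = 0 := by
      have hwe : inner 𝕜 w e = 0 := inner_eq_zero_symm.1 hew
      simp only [hu, hv, inner_add_left, inner_add_right, inner_smul_left, inner_smul_right, hew,
        hwe, inner_self_eq_norm_sq_to_K, he, hw, RCLike.conj_ofReal]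
      push_cast
      ring
    obtain ⟨j, hj⟩ := hU.exists_insert_of_inner_eq_zero hS hfin hu1 (fun p hp => by
      simp [hu, inner_add_right, inner_smul_right, hperp p hp, hUw p hp]) hqu
    obtain ⟨U', hUU', hfin', hU', hvU'⟩ := ih hj (hfin.insert _) hv1 (by
      rintro p (rfl | hp)
      · exact huv
      · simp [hv, inner_add_right, inner_smul_right, hperp p hp, hUw p hp]) hqv hcd
    refine ⟨U', (Set.subset_insert _ _).trans hUU', hfin', hU', ?_⟩
    have huU' : u ∈ Submodule.span 𝕜 (Prod.snd '' U') :=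
      Submodule.subset_span ⟨(j, u), hUU' (Set.mem_insert _ _), rfl⟩
    have heq : e = (x : 𝕜) • u + ((-y : ℝ) : 𝕜) • v := by
      have hxy' : (x : 𝕜) * x + y * y = 1 := by
        have := congrArg (fun r : ℝ => (r : 𝕜)) hxy
        simpa [sq] using this
      calc e = ((x : 𝕜) * x + y * y) • e := by rw [hxy', one_smul]
        _ = _ := by rw [hu, hv]; push_cast; module
    rw [heq]
    exact Submodule.add_mem _ (Submodule.smul_mem _ _ huU') (Submodule.smul_mem _ _ hvU')

include hS hε hval in
theorem IsIsotropicFamily.exists_mem_span {U : Set (ℕ × K)} (hU : IsIsotropicFamily S U)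
    (hfin : U.Finite) (e : K) :
    ∃ U', U ⊆ U' ∧ U'.Finite ∧ IsIsotropicFamily S U' ∧
      e ∈ Submodule.span 𝕜 (Prod.snd '' U') := by
  let F := Submodule.span 𝕜 (Prod.snd '' U)
  have : FiniteDimensional 𝕜 F := FiniteDimensional.span_of_finite 𝕜 (hfin.image _)
  by_cases he : e - F.starProjection e = 0
  · refine ⟨U, subset_rfl, hfin, hU, ?_⟩
    rw [sub_eq_zero.1 he]
    exact F.starProjection_apply_mem e
  set f := e - F.starProjection e with hf
  have hfF : f ∈ Fᗮ := F.sub_starProjection_mem_orthogonal e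
  have hf0 : ‖f‖ ≠ 0 := norm_ne_zero_iff.2 he
  set g : K := ((‖f‖⁻¹ : ℝ) : 𝕜) • f with hg
  have hg1 : ‖g‖ = 1 := by
    rw [hg, norm_smul, RCLike.norm_ofReal, abs_of_nonneg (by positivity), inv_mul_cancel₀ hf0]
  obtain ⟨n, hn⟩ := exists_nat_ge (|RCLike.re (inner 𝕜 g (S g))| / ε)
  obtain ⟨U', hUU', hfin', hU', hgU'⟩ := IsIsotropicFamily.exists_mem_span_of_unit hS hε hval n hU
    hfin hg1 (fun p hp => Submodule.smul_mem _ _ hfF _ (Submodule.subset_span ⟨p, hp, rfl⟩))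
    (inner_self_apply_eq_ofReal hS g) ((div_le_iff₀ hε).1 hn)
  refine ⟨U', hUU', hfin', hU', ?_⟩
  have heq : e = F.starProjection e + ((‖f‖ : ℝ) : 𝕜) • g := by
    rw [hg, smul_smul, ← RCLike.ofReal_mul, mul_inv_cancel₀ hf0, RCLike.ofReal_one, one_smul, hf]
    abel
  rw [heq]
  exact Submodule.add_mem _ (Submodule.span_mono (Set.image_mono hUU')
    (F.starProjection_apply_mem e)) (Submodule.smul_mem _ _ hgU')

include hS hε hval in
/-- Every sequence of vectors lies in the span of an isotropic family all of whose label classes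
are infinite. -/
theorem exists_isIsotropicFamily (e : ℕ → K) :
    ∃ U : Set (ℕ × K), IsIsotropicFamily S U ∧
      (∀ n, e n ∈ Submodule.span 𝕜 (Prod.snd '' U)) ∧ ∀ j, {w | (j, w) ∈ U}.Infinite := by
  -- Stage `n` absorbs `e n` and adds a new vector labelled `n.unpair.1`, so that every label recurs
  -- infinitely often.
  have step : ∀ (U : {U : Set (ℕ × K) // U.Finite ∧ IsIsotropicFamily S U}) (n : ℕ),
      ∃ U' : {U : Set (ℕ × K) // U.Finite ∧ IsIsotropicFamily S U}, U.1 ⊆ U'.1 ∧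
        e n ∈ Submodule.span 𝕜 (Prod.snd '' U'.1) ∧ ∃ w, (n.unpair.1, w) ∈ U'.1 \ U.1 := by
    intro U n
    obtain ⟨U', h1, h2, h3, h4⟩ := U.2.2.exists_mem_span hS hε hval U.2.1 (e n)
    obtain ⟨w, hw, hU''⟩ := h3.exists_insert hS hε hval h2 n.unpair.1
    exact ⟨⟨_, h2.insert _, hU''⟩, h1.trans (Set.subset_insert _ _),
      Submodule.span_mono (Set.image_mono (Set.subset_insert _ _)) h4, w,
      Set.mem_insert _ _, fun h => hw (h1 h)⟩
  choose f hf1 hf2 hf3 using step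
  let V : ℕ → {U : Set (ℕ × K) // U.Finite ∧ IsIsotropicFamily S U} := fun n =>
    Nat.rec ⟨∅, Set.finite_empty, ⟨by simp, by simp, by simp⟩⟩ (fun n U => f U n) n
  have hV : ∀ n, V (n + 1) = f (V n) n := fun n => rfl
  have hmono : Monotone fun n => (V n).1 := monotone_nat_of_le_succ fun n => by
    rw [hV]
    exact hf1 _ _
  have hpair : ∀ p ∈ ⋃ n, (V n).1, ∀ q ∈ ⋃ n, (V n).1, ∃ n, p ∈ (V n).1 ∧ q ∈ (V n).1 := by
    intro p hp q hq
    obtain ⟨m, hm⟩ := Set.mem_iUnion.1 hp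
    obtain ⟨n, hn⟩ := Set.mem_iUnion.1 hq
    exact ⟨max m n, hmono (le_max_left _ _) hm, hmono (le_max_right _ _) hn⟩
  refine ⟨⋃ n, (V n).1, ⟨fun p hp => ?_, fun p hp q hq => ?_, fun p hp q hq => ?_⟩, fun n => ?_,
    fun j hj => ?_⟩
  · obtain ⟨n, hn, -⟩ := hpair p hp p hp
    exact (V n).2.2.norm_eq p hn
  · obtain ⟨n, hpn, hqn⟩ := hpair p hp q hq
    exact (V n).2.2.inner_eq p hpn q hqn
  · obtain ⟨n, hpn, hqn⟩ := hpair p hp q hq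
    exact (V n).2.2.isotropic p hpn q hqn
  · refine Submodule.span_mono (Set.image_mono (Set.subset_iUnion _ (n + 1))) ?_
    rw [hV]
    exact hf2 _ _
  · have hlabel : {p ∈ ⋃ n, (V n).1 | p.1 = j}.Finite := by
      refine (hj.image (Prod.mk j)).subset ?_
      rintro ⟨i, w⟩ ⟨hp, rfl⟩
      exact ⟨w, hp, rfl⟩
    obtain ⟨N, hN⟩ : ∃ N, {p ∈ ⋃ n, (V n).1 | p.1 = j} ⊆ (V N).1 := by
      obtain ⟨N, hN⟩ := hmono.directed_le.exists_mem_subset_of_finset_subset_biUnion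
        (s := hlabel.toFinset) (by rw [hlabel.coe_toFinset]; exact fun p hp => hp.1)
      exact ⟨N, by rwa [hlabel.coe_toFinset] at hN⟩
    -- A finite class would be complete by stage `N`, but stage `Nat.pair j N ≥ N` still adds a new
    -- vector labelled `j`.
    obtain ⟨w, hw, hw'⟩ := hf3 (V (Nat.pair j N)) (Nat.pair j N)
    rw [← hV, Nat.unpair_pair] at hw
    rw [Nat.unpair_pair] at hw'
    exact hw' (hmono (Nat.right_le_pair j N) (hN ⟨Set.mem_iUnion.2 ⟨Nat.pair j N + 1, hw⟩, rfl⟩))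

end IsotropicFamilies

/-! ### From isotropic families to sums of projections. -/

section Decomposition

open scoped InnerProduct

variable {𝕜 K H : Type*} [RCLike 𝕜] [NormedAddCommGroup K] [InnerProductSpace 𝕜 K]
  [NormedAddCommGroup H] [InnerProductSpace 𝕜 H]

/-- Used with `B = 1` for orthogonality of different classes and with `B = T† T - 1` for isotropy
within one. -/
theorem inner_apply_eq_zero_of_mem_closure_span (B : K →L[𝕜] K) {V W : Set K}
    (h : ∀ a ∈ V, ∀ b ∈ W, inner 𝕜 a (B b) = 0) {a b : K}
    (ha : a ∈ (Submodule.span 𝕜 V).topologicalClosure)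
    (hb : b ∈ (Submodule.span 𝕜 W).topologicalClosure) : inner 𝕜 a (B b) = 0 := by
  have h1 : ∀ b ∈ W, inner 𝕜 a (B b) = 0 := fun b hb => by
    have hle : (Submodule.span 𝕜 V).topologicalClosure ≤ (𝕜 ∙ B b)ᗮ :=
      Submodule.topologicalClosure_minimal _ (Submodule.span_le.2 fun v hv =>
        Submodule.mem_orthogonal_singleton_iff_inner_left.2 (h v hv b hb))
        (Submodule.isClosed_orthogonal _)
    exact Submodule.mem_orthogonal_singleton_iff_inner_left.1 (hle ha)
  have hle : (Submodule.span 𝕜 W).topologicalClosure ≤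
      LinearMap.ker ((innerSL 𝕜 a).comp B : K →ₗ[𝕜] 𝕜) :=
    Submodule.topologicalClosure_minimal _ (Submodule.span_le.2 fun w hw => h1 w hw)
      (ContinuousLinearMap.isClosed_ker ((innerSL 𝕜 a).comp B))
  exact hle hb

theorem isStarProjection_sum_range [CompleteSpace K] {E : ℕ → (K →L[𝕜] K)}
    (hE : ∀ i, IsStarProjection (E i)) (hperp : ∀ i j, i ≠ j → E i * E j = 0) (n : ℕ) :
    IsStarProjection (∑ i ∈ Finset.range n, E i) := by
  induction n with
  | zero => simp
  | succ n ih =>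
    rw [Finset.sum_range_succ]
    refine ih.add (hE n) ?_
    rw [Finset.sum_mul]
    exact Finset.sum_eq_zero fun i hi => hperp i n (Finset.mem_range.1 hi).ne

theorem norm_sub_apply_le_of_isStarProjection [CompleteSpace K] {P : K →L[𝕜] K}
    (hP : IsStarProjection P) {g : K} (hg : P g = g) (y : K) : ‖P y - y‖ ≤ ‖y - g‖ := by
  have h1 : P y - y = -((1 - P) (y - g)) := by simp [hg]
  rw [h1, norm_neg]
  refine (ContinuousLinearMap.le_opNorm _ _).trans ?_
  exact mul_le_of_le_one_left (norm_nonneg _) hP.one_sub.norm_le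

/-- Mutually orthogonal projections whose ranges span a dense subspace sum to the identity in the
strong operator topology. -/
theorem tendsto_sum_starProjection [CompleteSpace K] {E : ℕ → (K →L[𝕜] K)}
    (hE : ∀ i, IsStarProjection (E i)) (hperp : ∀ i j, i ≠ j → E i * E j = 0) {V : Set K}
    (hV : ∀ v ∈ V, ∃ i, E i v = v) (hdense : (Submodule.span 𝕜 V).topologicalClosure = ⊤) (y : K) :
    Tendsto (fun n => (∑ i ∈ Finset.range n, E i) y) atTop (𝓝 y) := by
  -- On the algebraic span the partial sums are eventually exact; being projections, they carry this
  -- to the closure.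
  have hspan : ∀ g ∈ Submodule.span 𝕜 V, ∀ᶠ n in atTop, (∑ i ∈ Finset.range n, E i) g = g := by
    intro g hg
    induction hg using Submodule.span_induction with
    | mem v hv =>
      obtain ⟨i, hi⟩ := hV v hv
      filter_upwards [eventually_gt_atTop i] with n hn
      rw [_root_.sum_apply, Finset.sum_eq_single i, hi]
      · intro j _ hj
        rw [← hi, ← mul_apply_eq_comp, hperp j i hj]
        rfl
      · intro h
        exact absurd (Finset.mem_range.2 hn) h
    | zero => simp
    | add a b _ _ ha hb =>
      filter_upwards [ha, hb] with n h1 h2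
      rw [map_add, h1, h2]
    | smul c a _ ha =>
      filter_upwards [ha] with n h1
      rw [map_smul, h1]
  rw [Metric.tendsto_atTop]
  intro δ hδ
  have hy : y ∈ closure (Submodule.span 𝕜 V : Set K) := by
    rw [← Submodule.topologicalClosure_coe, hdense]
    trivial
  obtain ⟨g, hg, hyg⟩ := Metric.mem_closure_iff.1 hy δ hδ
  obtain ⟨N, hN⟩ := eventually_atTop.1 (hspan g hg)
  refine ⟨N, fun n hn => ?_⟩
  rw [dist_eq_norm] at hyg ⊢
  exact (norm_sub_apply_le_of_isStarProjection (isStarProjection_sum_range hE hperp n)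
    (hN n hn) y).trans_lt hyg

/-- If `T† T - 1` has a total isotropic family with infinite label classes, then `T T†` is a sum of
infinite rank projections. -/
theorem IsIsotropicFamily.hasInfiniteRankProjectionDecomposition [CompleteSpace K]
    [CompleteSpace H] {T : K →L[𝕜] H} {U : Set (ℕ × K)}
    (hU : IsIsotropicFamily ((T†).comp T - 1) U)
    (hdense : (Submodule.span 𝕜 (Prod.snd '' U)).topologicalClosure = ⊤)
    (hinf : ∀ j, {w | (j, w) ∈ U}.Infinite) :
    HasInfiniteRankProjectionDecomposition (T.comp (T†)) := by
  let G : ℕ → Submodule 𝕜 K := fun j => (Submodule.span 𝕜 {w | (j, w) ∈ U}).topologicalClosure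
  have hGc : ∀ j, CompleteSpace (G j) := fun j =>
    (Submodule.isClosed_topologicalClosure _).completeSpace_coe
  let E : ℕ → (K →L[𝕜] K) := fun j => (G j).starProjection
  have hE : ∀ j, IsStarProjection (E j) := fun j => isStarProjection_starProjection
  have hEmem : ∀ j x, E j x ∈ G j := fun j x => Submodule.starProjection_apply_mem _ x
  have hEself : ∀ j, ∀ x ∈ G j, E j x = x := fun j x hx => Submodule.starProjection_eq_self_iff.2 hx
  have hEzero : ∀ j x, (∀ a ∈ G j, inner 𝕜 a x = 0) → E j x = 0 := fun j x hx =>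
    ((G j).starProjection_apply_eq_zero_iff).2 hx
  have hVG : ∀ j w, (j, w) ∈ U → w ∈ G j := fun j w hw =>
    Submodule.le_topologicalClosure _ (Submodule.subset_span hw)
  have hGG : ∀ i j, i ≠ j → ∀ a ∈ G i, ∀ b ∈ G j, inner 𝕜 a b = 0 := by
    intro i j hij a ha b hb
    refine inner_apply_eq_zero_of_mem_closure_span (1 : K →L[𝕜] K) ?_ ha hb
    intro v hv w hw
    exact hU.inner_eq (i, v) hv (j, w) hw fun h => hij (congrArg Prod.fst h)
  have hiso : ∀ j, ∀ a ∈ G j, ∀ b ∈ G j, inner 𝕜 a (((T†).comp T - 1) b) = 0 := by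
    intro j a ha b hb
    refine inner_apply_eq_zero_of_mem_closure_span ((T†).comp T - 1) ?_ ha hb
    intro v hv w hw
    exact hU.isotropic (j, v) hv (j, w) hw rfl
  have hperp : ∀ i j, i ≠ j → E i * E j = 0 := by
    intro i j hij
    ext x
    exact hEzero i _ fun a ha => hGG i j hij a ha _ (hEmem j x)
  -- Isotropy in operator form: `T` is isometric on `G j`.
  have hETT : ∀ j, ∀ x ∈ G j, E j ((T†) (T x)) = x := by
    intro j x hx
    have h1 := hEzero j _ fun a ha => hiso j a ha x hx
    have h2 : ((T†).comp T - 1) x = (T†) (T x) - x := rfl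
    rw [h2, map_sub, hEself j x hx, sub_eq_zero] at h1
    exact h1
  let P : ℕ → (H →L[𝕜] H) := fun j => T.comp ((E j).comp (T†))
  have hPT : ∀ j, ∀ x ∈ G j, P j (T x) = T x := fun j x hx => congrArg T (hETT j x hx)
  refine Or.inr ⟨P, fun j => ⟨⟨?_, ?_⟩, ?_⟩, fun x => ?_⟩
  · ext x
    exact hPT j _ (hEmem j _)
  · rw [ContinuousLinearMap.isSelfAdjoint_iff']
    simp only [P, ContinuousLinearMap.adjoint_comp, ContinuousLinearMap.adjoint_adjoint]
    rw [ContinuousLinearMap.isSelfAdjoint_iff'.1 (hE j).isSelfAdjoint, ContinuousLinearMap.comp_assoc]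
  -- The map `E j T†` would send a finite-dimensional range onto a space containing the infinite
  -- orthonormal class `j`.
  · intro hfin
    let L : H →ₗ[𝕜] K := ((E j).comp (T†) : H →L[𝕜] K)
    have hfin' : FiniteDimensional 𝕜
        ((LinearMap.range (P j : H →ₗ[𝕜] H)).map L) := inferInstance
    have hli : LinearIndependent 𝕜 (fun w : {w | (j, w) ∈ U} => (w : K)) := by
      refine Orthonormal.linearIndependent ⟨fun w => hU.norm_eq (j, w) w.2, fun v w hvw => ?_⟩
      exact hU.inner_eq (j, v) v.2 (j, w) w.2 fun h => hvw (Subtype.ext (congrArg Prod.snd h))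
    have hmem : ∀ w : {w | (j, w) ∈ U}, (w : K) ∈ (LinearMap.range (P j : H →ₗ[𝕜] H)).map L :=
      fun w => ⟨T w, ⟨T w, hPT j _ (hVG j _ w.2)⟩, hETT j _ (hVG j _ w.2)⟩
    have hli' : LinearIndependent 𝕜 (fun w : {w | (j, w) ∈ U} =>
        (⟨w, hmem w⟩ : (LinearMap.range (P j : H →ₗ[𝕜] H)).map L)) :=
      LinearIndependent.of_comp (Submodule.subtype _) hli
    have := hli'.finite
    exact hinf j (Set.toFinite _)
  · have h := (T.continuous.tendsto _).comp
      (tendsto_sum_starProjection hE hperp (V := Prod.snd '' U) (by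
        rintro _ ⟨p, hp, rfl⟩
        exact ⟨p.1, hEself _ _ (hVG p.1 p.2 hp)⟩) hdense ((T†) x))
    refine h.congr fun n => ?_
    simp only [Function.comp_apply, _root_.sum_apply, map_sum]
    rfl

/-- An infinite-dimensional subspace meets every finite-codimensional one. -/
theorem exists_unit_mem_orthogonal {M : Submodule 𝕜 K} (hM : ¬ FiniteDimensional 𝕜 M)
    (F : Submodule 𝕜 K) [FiniteDimensional 𝕜 F] : ∃ w ∈ M, w ∈ Fᗮ ∧ ‖w‖ = 1 := by
  let L : M →ₗ[𝕜] F := (F.orthogonalProjectionOnto.comp M.subtypeL : M →L[𝕜] F)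
  have hL : ¬ Function.Injective L := fun h => hM (FiniteDimensional.of_injective L h)
  rw [← LinearMap.ker_eq_bot, Submodule.eq_bot_iff] at hL
  push Not at hL
  obtain ⟨x, hx, hx0⟩ := hL
  have hxF : (x : K) ∈ Fᗮ := Submodule.orthogonalProjectionOnto_eq_zero_iff.1 hx
  have hx0' : ‖(x : K)‖ ≠ 0 := by simpa using hx0
  refine ⟨((‖(x : K)‖⁻¹ : ℝ) : 𝕜) • (x : K), M.smul_mem _ x.2, Submodule.smul_mem _ _ hxF, ?_⟩
  rw [norm_smul, RCLike.norm_ofReal, abs_of_nonneg (by positivity), inv_mul_cancel₀ hx0']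

/-- A positive operator which is bounded below by a constant greater than `1` on an
infinite-dimensional subspace is a sum of infinite rank projections. -/
theorem hasInfiniteRankProjectionDecomposition_of_bounded_below [CompleteSpace H]
    [TopologicalSpace.SeparableSpace H] {A : H →L[𝕜] H} (hA : A.IsPositive) {ε : ℝ} (hε : 0 < ε)
    {M : Submodule 𝕜 H} (hM : ¬ FiniteDimensional 𝕜 M)
    (hbound : ∀ x ∈ M, (1 + ε) * ‖x‖ ^ 2 ≤ RCLike.re (inner 𝕜 x (A x))) :
    HasInfiniteRankProjectionDecomposition A := by
  obtain ⟨R, hR, hRA⟩ := exists_isSelfAdjoint_mul_self_eq hA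
  -- The second summand leaves `T T† = A` unchanged but supplies negative directions, since `A - 1`
  -- alone may have none: `T† T - 1 = (A - 1) ⊕ (-1)`.
  let T : WithLp 2 (H × H) →L[𝕜] H := R.comp (WithLp.fstL 2 𝕜 H H)
  have hRR : ∀ x, R (R x) = A x := fun x => by rw [← hRA]; rfl
  have hT : ∀ z, T z = R z.fst := fun z => rfl
  have hTadj : ∀ x, (T†) x = WithLp.toLp 2 (R x, 0) := fun x => by
    refine ext_inner_right 𝕜 fun z => ?_
    rw [ContinuousLinearMap.adjoint_inner_left, hT, WithLp.prod_inner_apply]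
    simp only [inner_zero_left, add_zero]
    exact (ContinuousLinearMap.isSelfAdjoint_iff_isSymmetric.1 hR x z.fst).symm
  have hTT : T.comp (T†) = A := by
    ext x
    rw [ContinuousLinearMap.comp_apply, hTadj, hT]
    exact hRR x
  have hS : ∀ x y, inner 𝕜 (((T†).comp T - 1) x) y = inner 𝕜 x (((T†).comp T - 1) y) := fun x y => by
    change inner 𝕜 ((T†) (T x) - x) y = inner 𝕜 x ((T†) (T y) - y)
    rw [inner_sub_left, inner_sub_right, ContinuousLinearMap.adjoint_inner_left,
      ContinuousLinearMap.adjoint_inner_right]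
  have hq : ∀ z, RCLike.re (inner 𝕜 z (((T†).comp T - 1) z)) = ‖T z‖ ^ 2 - ‖z‖ ^ 2 := fun z => by
    change RCLike.re (inner 𝕜 z ((T†) (T z) - z)) = _
    rw [inner_sub_right, ContinuousLinearMap.adjoint_inner_right, map_sub, inner_self_eq_norm_sq,
      inner_self_eq_norm_sq]
  have hTsq : ∀ z, ‖T z‖ ^ 2 = RCLike.re (inner 𝕜 z.fst (A z.fst)) := fun z => by
    have h : inner 𝕜 (R z.fst) (R z.fst) = inner 𝕜 z.fst (R (R z.fst)) :=
      ContinuousLinearMap.isSelfAdjoint_iff_isSymmetric.1 hR z.fst (R z.fst)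
    rw [hT, ← hRR, ← h, inner_self_eq_norm_sq]
  let ι₁ : H →ₗ[𝕜] WithLp 2 (H × H) :=
    (WithLp.linearEquiv 2 𝕜 (H × H)).symm.toLinearMap ∘ₗ LinearMap.inl 𝕜 H H
  let ι₂ : H →ₗ[𝕜] WithLp 2 (H × H) :=
    (WithLp.linearEquiv 2 𝕜 (H × H)).symm.toLinearMap ∘ₗ LinearMap.inr 𝕜 H H
  have hι₁ : Function.Injective ι₁ := fun x y h => congrArg (fun z => z.fst) h
  have hι₂ : Function.Injective ι₂ := fun x y h => congrArg (fun z => z.snd) h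
  have hM₁ : ¬ FiniteDimensional 𝕜 (M.map ι₁) := fun h =>
    hM (LinearEquiv.finiteDimensional (Submodule.equivMapOfInjective ι₁ hι₁ M).symm)
  have hM₂ : ¬ FiniteDimensional 𝕜 (M.map ι₂) := fun h =>
    hM (LinearEquiv.finiteDimensional (Submodule.equivMapOfInjective ι₂ hι₂ M).symm)
  -- The form is at least `ε` on unit vectors of `M ⊕ 0` and equals `-1` on those of `0 ⊕ M`.
  have hδ : 0 < min ε 1 := lt_min hε one_pos
  have hval := fun F hF d hd => exists_unit_inner_eq (S := (T†).comp T - 1) hS hδ (fun F hF => by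
    obtain ⟨w, ⟨x, hx, rfl⟩, hwF, hw⟩ := exists_unit_mem_orthogonal hM₁ F
    refine ⟨_, hwF, hw, ?_⟩
    have hnorm : ‖x‖ = 1 := by
      rw [← hw]
      exact (WithLp.norm_toLp_fst 2 H H x).symm
    have hb := hbound x hx
    rw [hq, hw, hTsq]
    change _ ≤ RCLike.re (inner 𝕜 x (A x)) - _
    rw [hnorm] at hb
    linarith [min_le_left ε 1]) (fun F hF => by
    obtain ⟨w, ⟨x, hx, rfl⟩, hwF, hw⟩ := exists_unit_mem_orthogonal hM₂ F
    refine ⟨_, hwF, hw, ?_⟩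
    have h0 : T (ι₂ x) = 0 := map_zero R
    rw [hq, hw, h0, norm_zero]
    linarith [min_le_right ε 1]) F hF (d := d) hd
  have hsep : TopologicalSpace.SeparableSpace (WithLp 2 (H × H)) :=
    (WithLp.homeomorphProd 2 H H).symm.surjective.denseRange.separableSpace
      (WithLp.homeomorphProd 2 H H).symm.continuous
  obtain ⟨U, hU, he, hinf⟩ := exists_isIsotropicFamily hS hδ hval
    (TopologicalSpace.denseSeq (WithLp 2 (H × H)))
  rw [← hTT]
  refine hU.hasInfiniteRankProjectionDecomposition ?_ hinf
  rw [← Submodule.dense_iff_topologicalClosure_eq_top]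
  refine (TopologicalSpace.denseRange_denseSeq _).mono ?_
  rintro _ ⟨n, rfl⟩
  exact he n

end Decomposition

theorem proposition10 {𝕜 H : Type*} [RCLike 𝕜] [NormedAddCommGroup H] [InnerProductSpace 𝕜 H]
    [CompleteSpace H] [TopologicalSpace.SeparableSpace H]
    (A : H →L[𝕜] H) (hA : A.IsPositive)
    (hspec : ∀ P : H →L[𝕜] H, IsSpectralProjection A P → P ≠ 0 → HasInfiniteRank P)
    (hnorm : 1 < ‖A‖) :
    HasInfiniteRankProjectionDecomposition A := by
  obtain ⟨ε, hε, M, hM, hbound⟩ := exists_infinite_subspace_bounded_below hA hspec hnorm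
  exact hasInfiniteRankProjectionDecomposition_of_bounded_below hA hε hM hbound
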